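/- **Conventions.** A *symmetric inner function* on the upper half plane $\mathbb C_+$ is a bounded analytic $\varphi:\mathbb C_+\to\mathbb C$ whose boundary values (limits from above) satisfy $\varphi(-p)=\overline{\varphi(p)}=\varphi(p)^{-1}$ for almost all $p\ge 0$. Let $(p_n)$ be its zeros in $\mathbb C_+$, counted with multiplicity; they occur in pairs $(p_n,-\overline{p_n})$. Its convergence exponent is $\rho_\varphi=\inf\{\alpha\ge 0:\sum_n|p_n|^{-\alpha}<\infty\}\in[0,\infty]$. It is a *symmetric Blaschke product* if $\sum_n\frac{\operatorname{Im}p_n}{1+|p_n|^2}<\infty$ and $\varphi(p)=\prod_n\frac{p-p_n}{p-\overline{p_n}}$, locally uniformly on $\mathbb C_+$, where the limit is taken over finite sets of zeros that contain with each zero $p_n$ its partner $-\overline{p_n}$. The canonical factorization of $\varphi$ is $$\varphi(p)=\pm e^{ipx_\varphi}\,B(p)\,\exp\Big(-i\int_{\mathbb R}\frac{1+pt}{p-t}\,d\mu_\varphi(t)\Big),\qquad p\in\mathbb C_+,$$ with $x_\varphi\ge 0$, $B$ the Blaschke product over the zeros of $\varphi$ (with the usual convergence factors $|1+p_n^2|/(1+p_n^2)$,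 read as $1$ if $p_n=i$), and $\mu_\varphi$ a finite, symmetric, Lebesgue-singular measure on $\mathbb R$. On $\mathcal H=L^2(\mathbb R,d\theta)$ let $(T(a)\psi)(\theta)=e^{iae^\theta}\psi(\theta)$, $(\Delta^{it}\psi)(\theta)=\psi(\theta-2\pi t)$, $(J\psi)(\theta)=\overline{\psi(\theta)}$, let $H=\ker(1-J\Delta^{1/2})$ (the irreducible one-dimensional standard pair $(H,T)$), and let $H'$ be the symplectic complement of $H$ with respect to $\operatorname{Im}\langle\cdot,\cdot\rangle$. For a symmetric inner function $\varphi$ let $(\varphi(P)\psi)(\theta)=\varphi(e^\theta)\psi(\theta)$ (boundary values) and $H_\varphi(a,b)=T(a)\varphi(P)H\cap T(b)H'$. The *minimal localization radius* is $r_\varphi=\inf\{r\ge 0: H_\varphi(-r,r)\ne\{0\}\}\in[0,\infty]$. **Statement.** Let $\nu,q>0$, $s_{\nu,q}(p)=i\sin(\nu p-iq)$ and $\varphi=s_{\nu,q}/s_{\nu,-q}$, i.e. $\varphi(p)=\sin(\nu p-iq)/\sin(\nu p+iq)$. Then $\varphi$ is a symmetric inner function and a symmetric Blaschke product; it has a canonical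 factorization with $x_\varphi=0$ and $\mu_\varphi=0$, and this is the only possible choice of $(x_\varphi,\mu_\varphi)$; its convergence exponent is $\rho_\varphi=1$; and its minimal localization radius is exactly $r_\varphi=\nu$. Consequently, for every $r\in(0,\infty)$ there is a symmetric Blaschke product $\varphi$ with $x_\varphi=0$, $\mu_\varphi=0$ (uniquely), $\rho_\varphi=1$ and $r_\varphi=r$. -/

import Mathlib

open MeasureTheory Filter Topology Set
open scoped ComplexConjugate NNReal ENNReal FourierTransform InnerProductSpace

noncomputable section

namespace LocalizationRadius

/-! ### Symmetric inner functions and their canonical factorization -/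

/-- The open upper half plane `ℂ₊`, as a subset of `ℂ`. Functions on `ℂ₊` are represented by
functions `ℂ → ℂ` of which only the values on `ℂ₊` matter. -/
def upperHalf : Set ℂ := {p | 0 < p.im}

/-- A symmetric inner function on `ℂ₊`: analytic, bounded, and for almost all `p ≥ 0` the boundary
values (limits from above along the vertical direction) at `p` and `-p` exist and satisfy
`φ(-p) = conj φ(p) = φ(p)⁻¹`. -/
structure IsSymmetricInner (φ : ℂ → ℂ) : Prop where
  analytic : DifferentiableOn ℂ φ upperHalf
  bounded : ∃ C : ℝ, ∀ p ∈ upperHalf, ‖φ p‖ ≤ C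
  boundary : ∀ᵐ p : ℝ, 0 ≤ p → ∃ w : ℂ,
    Tendsto (fun ε : ℝ => φ ((p : ℂ) + (ε : ℂ) * Complex.I)) (𝓝[>] 0) (𝓝 w) ∧
    Tendsto (fun ε : ℝ => φ (-(p : ℂ) + (ε : ℂ) * Complex.I)) (𝓝[>] 0) (𝓝 (conj w)) ∧
    w ≠ 0 ∧ conj w = w⁻¹

/-- The set of zeros of `φ` in the upper half plane. -/
def zeros (φ : ℂ → ℂ) : Set ℂ := {p | 0 < p.im ∧ φ p = 0}

/-- The multiplicity of a zero. -/
def mult (φ : ℂ → ℂ) (a : zeros φ) : ℕ := analyticOrderNatAt φ (a : ℂ)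

/-- The Blaschke condition `∑ Im pₙ / (1 + |pₙ|²) < ∞` over the zeros, counted with multiplicity. -/
def BlaschkeCondition (φ : ℂ → ℂ) : Prop :=
  Summable fun a : zeros φ => (mult φ a : ℝ) * ((a : ℂ).im / (1 + ‖(a : ℂ)‖ ^ 2))

/-- The convergence exponent `ρ = inf {α ≥ 0 : ∑ |pₙ|^{-α} < ∞}` of the zeros, counted with
multiplicity, as an element of `[0, ∞]`. -/
def convergenceExponent (φ : ℂ → ℂ) : ℝ≥0∞ :=
  ⨅ (α : ℝ≥0) (_ : Summable fun a : zeros φ => (mult φ a : ℝ) * ‖(a : ℂ)‖ ^ (-(α : ℝ))), (α : ℝ≥0∞)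

/-- A finite set of zeros is symmetric if it is stable under `a ↦ -conj a`. -/
def IsSymmetricFinset {φ : ℂ → ℂ} (s : Finset (zeros φ)) : Prop :=
  ∀ a ∈ s, ∃ b ∈ s, (b : ℂ) = -conj (a : ℂ)

/-- `φ` is a symmetric Blaschke product `φ(p) = ∏ₙ (p - pₙ) / (p - conj pₙ)`, `pₙ` being the zeros
of `φ` counted with multiplicity. The zeros occur in pairs `(pₙ, -conj pₙ)`, and the product is the
limit, locally uniformly on `ℂ₊`, of the products over the finite sets of zeros that contain with
each zero its partner, directed by inclusion. -/
structure IsSymmetricBlaschkeProduct (φ : ℂ → ℂ) : Prop where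
  inner : IsSymmetricInner φ
  summable : BlaschkeCondition φ
  product : TendstoLocallyUniformlyOn
    (fun (s : {s : Finset (zeros φ) // IsSymmetricFinset s}) (p : ℂ) =>
      ∏ a ∈ s.1, ((p - (a : ℂ)) / (p - conj (a : ℂ))) ^ mult φ a)
    φ atTop upperHalf

open Classical in
/-- The usual factor of a Blaschke product of the upper half plane, including the unimodular
convergence factor `|1 + a²| / (1 + a²)` (to be read as `1` for `a = i`). -/
def blaschkeFactor (a p : ℂ) : ℂ :=
  (if a = Complex.I then 1 else (‖1 + a ^ 2‖ : ℂ) / (1 + a ^ 2)) * ((p - a) / (p - conj a))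

/-- The singular factor `S(p) = exp (-i ∫ (1 + p t) / (p - t) dμ(t))`. -/
def singularFactor (μ : Measure ℝ) (p : ℂ) : ℂ :=
  Complex.exp (-Complex.I * ∫ t : ℝ, (1 + p * (t : ℂ)) / (p - (t : ℂ)) ∂μ)

/-- The canonical factorization `φ(p) = ± e^{ipx} B(p) S(p)` on `ℂ₊`, with `x ≥ 0`, `B` the
Blaschke product over the zeros of `φ` (counted with multiplicity), and `μ` a finite symmetric
measure on `ℝ`, singular with respect to Lebesgue measure. For a symmetric zero set the
convergence factors of `B` can only contribute a sign, which is absorbed in `±`. -/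
structure IsCanonicalFactorization (φ : ℂ → ℂ) (x : ℝ) (μ : Measure ℝ) : Prop where
  shift_nonneg : 0 ≤ x
  finite : IsFiniteMeasure μ
  singular : μ ⟂ₘ (volume : Measure ℝ)
  symmetric : μ.map (fun t : ℝ => -t) = μ
  summable : BlaschkeCondition φ
  factorization : ∃ (σ : ℂ) (B : ℂ → ℂ), (σ = 1 ∨ σ = -1) ∧
    HasProdLocallyUniformlyOn (fun (a : zeros φ) (p : ℂ) => blaschkeFactor (a : ℂ) p ^ mult φ a)
      B upperHalf ∧
    ∀ p ∈ upperHalf, φ p = σ * Complex.exp (Complex.I * p * (x : ℂ)) * B p * singularFactor μ p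

/-! ### The irreducible one-dimensional standard pair and its endomorphism nets

We use the rapidity representation on `L²(ℝ, dθ)`, where the light ray momentum is `P = e^θ`,
`(T(a)ψ)(θ) = exp(i a e^θ) ψ(θ)`, `(Δ^{it}ψ)(θ) = ψ(θ - 2πt)` and `(Jψ)(θ) = conj (ψ(θ))`. -/

/-- The Hilbert space `L²(ℝ, dθ)`. -/
abbrev HilbertSpace : Type := Lp ℂ 2 (volume : Measure ℝ)

/-- `IsModularPower z ψ χ` says that `ψ` is in the domain of `Δ^z` and `Δ^z ψ = χ`.
The translations `(Δ^{it}ψ)(θ) = ψ(θ - 2πt)` are diagonalized by the Fourier transform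
`(𝓕 ψ)(ξ) = ∫ e^{-2πiξθ} ψ(θ) dθ`, in which `Δ^{it}` multiplies by `e^{-4π²itξ}`;
hence `log Δ` is multiplication by `-4π²ξ`. -/
def IsModularPower (z : ℂ) (ψ χ : HilbertSpace) : Prop :=
  (𝓕 χ : HilbertSpace) =ᵐ[volume]
    fun ξ : ℝ => Complex.exp (z * ((-4 * Real.pi ^ 2 * ξ : ℝ) : ℂ)) * (𝓕 ψ : HilbertSpace) ξ

theorem isModularPower_zero (z : ℂ) : IsModularPower z 0 0 := by
  have h : (𝓕 (0 : HilbertSpace) : HilbertSpace) = 0 :=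
    (Lp.fourierTransformₗᵢ ℝ ℂ).map_zero
  unfold IsModularPower
  rw [h]
  filter_upwards with ξ
  simp

theorem IsModularPower.add {z : ℂ} {ψ χ ψ' χ' : HilbertSpace} (h : IsModularPower z ψ χ)
    (h' : IsModularPower z ψ' χ') : IsModularPower z (ψ + ψ') (χ + χ') := by
  unfold IsModularPower at *
  rw [FourierTransform.fourier_add, FourierTransform.fourier_add]
  filter_upwards [h, h', Lp.coeFn_add (𝓕 χ : HilbertSpace) (𝓕 χ'),
    Lp.coeFn_add (𝓕 ψ : HilbertSpace) (𝓕 ψ')] with ξ h1 h2 h3 h4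
  rw [h3, h4, Pi.add_apply, Pi.add_apply, h1, h2, mul_add]

theorem IsModularPower.smul {z : ℂ} {ψ χ : HilbertSpace} (c : ℝ) (h : IsModularPower z ψ χ) :
    IsModularPower z (c • ψ) (c • χ) := by
  have e : ∀ η : HilbertSpace, c • η = (c : ℂ) • η := fun η => (Complex.coe_smul c η).symm
  unfold IsModularPower at *
  rw [e, e, FourierTransform.fourier_smul, FourierTransform.fourier_smul]
  filter_upwards [h, Lp.coeFn_smul (c : ℂ) (𝓕 χ : HilbertSpace),
    Lp.coeFn_smul (c : ℂ) (𝓕 ψ : HilbertSpace)] with ξ h1 h3 h4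
  rw [h3, h4, Pi.smul_apply, Pi.smul_apply, h1, smul_eq_mul, smul_eq_mul]
  ring

/-- The modular conjugation `(Jψ)(θ) = conj (ψ(θ))`. -/
def modularConj (ψ : HilbertSpace) : HilbertSpace := star ψ

theorem modularConj_coe (ψ : HilbertSpace) :
    modularConj ψ =ᵐ[volume] fun θ => conj (ψ θ) := Lp.coeFn_star ψ

theorem modularConj_add (ψ χ : HilbertSpace) :
    modularConj (ψ + χ) = modularConj ψ + modularConj χ := by
  apply Lp.ext
  filter_upwards [modularConj_coe (ψ + χ), modularConj_coe ψ, modularConj_coe χ,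
    Lp.coeFn_add ψ χ, Lp.coeFn_add (modularConj ψ) (modularConj χ)] with θ h1 h2 h3 h4 h5
  rw [h1, h5, h4, Pi.add_apply, Pi.add_apply, h2, h3, map_add]

theorem modularConj_smul (c : ℝ) (ψ : HilbertSpace) :
    modularConj (c • ψ) = c • modularConj ψ := by
  apply Lp.ext
  filter_upwards [modularConj_coe (c • ψ), modularConj_coe ψ,
    Lp.coeFn_smul c ψ, Lp.coeFn_smul c (modularConj ψ)] with θ h1 h2 h3 h4
  rw [h1, h4, h3, Pi.smul_apply, Pi.smul_apply, h2, Complex.real_smul, Complex.real_smul,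
    map_mul, Complex.conj_ofReal]

/-- The standard subspace `H = ker (1 - J Δ^{1/2})`. -/
def standardSubspace : Submodule ℝ HilbertSpace where
  carrier := {ψ | ∃ χ, IsModularPower (1 / 2) ψ χ ∧ modularConj χ = ψ}
  zero_mem' := ⟨0, isModularPower_zero _, by simpa using modularConj_smul 0 0⟩
  add_mem' := by
    rintro _ _ ⟨χ, h, rfl⟩ ⟨χ', h', rfl⟩
    exact ⟨χ + χ', h.add h', modularConj_add _ _⟩
  smul_mem' := by
    rintro c _ ⟨χ, h, rfl⟩
    exact ⟨c • χ, h.smul c, modularConj_smul _ _⟩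

/-- The symplectic complement `K'` with respect to `Im ⟪·, ·⟫`. -/
def symplecticComplement (K : Submodule ℝ HilbertSpace) : Submodule ℝ HilbertSpace where
  carrier := {ψ | ∀ η ∈ K, (⟪η, ψ⟫_ℂ).im = 0}
  zero_mem' := by simp
  add_mem' := by
    intro ψ χ h h' η hη
    rw [inner_add_right, Complex.add_im, h η hη, h' η hη, add_zero]
  smul_mem' := by
    intro c ψ h η hη
    have e : c • ψ = (c : ℂ) • ψ := (Complex.coe_smul c ψ).symm
    rw [e, inner_smul_right, Complex.im_ofReal_mul, h η hη, mul_zero]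

/-- The image `{m · η : η ∈ K}` of a real subspace under multiplication by the function `m`. -/
def mulImage (m : ℝ → ℂ) (K : Submodule ℝ HilbertSpace) : Submodule ℝ HilbertSpace where
  carrier := {χ | ∃ η ∈ K, χ =ᵐ[volume] fun θ => m θ * η θ}
  zero_mem' := by
    refine ⟨0, K.zero_mem, ?_⟩
    filter_upwards with θ
    simp
  add_mem' := by
    rintro χ χ' ⟨η, hη, h⟩ ⟨η', hη', h'⟩
    refine ⟨η + η', K.add_mem hη hη', ?_⟩
    filter_upwards [h, h', Lp.coeFn_add χ χ', Lp.coeFn_add η η'] with θ h1 h2 h3 h4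
    rw [h3, h4, Pi.add_apply, Pi.add_apply, h1, h2, mul_add]
  smul_mem' := by
    rintro c χ ⟨η, hη, h⟩
    refine ⟨c • η, K.smul_mem c hη, ?_⟩
    filter_upwards [h, Lp.coeFn_smul c χ, Lp.coeFn_smul c η] with θ h1 h3 h4
    rw [h3, h4, Pi.smul_apply, Pi.smul_apply, h1, mul_smul_comm]

/-- The function of `θ` by which the translation `T(a) = e^{iaP}` multiplies. -/
def translation (a : ℝ) (θ : ℝ) : ℂ := Complex.exp (Complex.I * (a : ℂ) * (Real.exp θ : ℂ))

/-- The boundary value `φ(p) = lim_{ε ↘ 0} φ(p + iε)` at `p ∈ ℝ`. -/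
def boundaryValue (φ : ℂ → ℂ) (p : ℝ) : ℂ :=
  limUnder (𝓝[>] (0 : ℝ)) fun ε : ℝ => φ ((p : ℂ) + (ε : ℂ) * Complex.I)

/-- The local subspace `H_φ(I) = T(a) φ(P) H ∩ T(b) H'` of the interval `I = (a, b)`. -/
def localSubspace (φ : ℂ → ℂ) (a b : ℝ) : Submodule ℝ HilbertSpace :=
  mulImage (translation a) (mulImage (fun θ => boundaryValue φ (Real.exp θ)) standardSubspace) ⊓
    mulImage (translation b) (symplecticComplement standardSubspace)

/-- The minimal localization radius `r_φ = inf {r ≥ 0 : H_φ((-r, r)) ≠ {0}}` in `[0, ∞]`. -/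
def localizationRadius (φ : ℂ → ℂ) : ℝ≥0∞ :=
  ⨅ (r : ℝ≥0) (_ : localSubspace φ (-(r : ℝ)) (r : ℝ) ≠ ⊥), (r : ℝ≥0∞)

/-! ### The example -/

/-- `s_{ν,q}(p) = i sin (ν p - i q)`. -/
def sinFun (ν q : ℝ) (p : ℂ) : ℂ :=
  Complex.I * Complex.sin ((ν : ℂ) * p - Complex.I * (q : ℂ))

/-- `φ = s_{ν,q} / s_{ν,-q}`. -/
def sinRatio (ν q : ℝ) (p : ℂ) : ℂ := sinFun ν q p / sinFun ν (-q) p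

end LocalizationRadius

end

/-! Put `A(p) = e^{iνp} s_{ν,-q}(p)` (`outerPart`). For `Im p ≥ 0` both `A` and `1/A` are bounded,
because `|e^{2iνp-q}| ≤ e^{-q} < e^q`. For real `p`, `A(-p) = conj A(p)` and `φ(p) = -e^{2iνp} conj
A(p) / A(p)`. Up to a sign and the quotient `conj A / A`, `φ` therefore acts as a translation by
`2ν`, and this fixes the radius.

A vector of `H_φ(-r, r)` has the form `T(-r)φh = T(r)h'` with `h ∈ H`, `h' ∈ H'`, so that `u =
e^{2i(ν-r)p} A⁻¹ h = -(conj A)⁻¹ h'`. Bounded symmetric holomorphic functions of the momentum map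
`H` into itself, hence their adjoints map `H'` into itself. If `r ≤ ν`, this puts `u` in `H ∩ H' =
{0}` (`localSubspace_eq_bot`). If `r > ν`, the choice `h = A k`, `h' = conj h` works for any
suitable `k` with `conj k = -e^{-2i(r-ν)p} k`; such a `k` is `kernel` (`localSubspace_ne_bot`).

What is needed about `H` rests on reading `Δ^{1/2}` as analytic continuation from `Im θ = 0` to `Im
θ = π`; under `p = e^θ` this strip becomes the closed upper half plane without `0`. Gaussians give
enough explicit vectors to test the graph of `Δ^{1/2}`.

The product formula is Euler's sine product over symmetric ranges of zeros. The Blaschke condition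
upgrades it to locally uniform convergence over all finite sets, once convergence factors are
inserted; these cancel in pairs `±n` and leave one sign. Comparing moduli at one point of the
imaginary axis then forces `x = 0` and `μ = 0`. The exponent is `1` because the zeros `(πn + iq)/ν`
grow linearly in `n`. -/

noncomputable section

namespace LocalizationRadius

/-! ### The Fourier transform on `L¹ ∩ L²` -/

/-- On `L¹ ∩ L²` the Fourier transform of `L²` is given by the Fourier integral. -/
theorem fourier_toLp_ae_eq {f : ℝ → ℂ} (h1 : Integrable f) (h2 : MemLp f 2) :
    (𝓕 (h2.toLp f) : HilbertSpace) =ᵐ[volume] 𝓕 f := by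
  have hc : Continuous (𝓕 f) :=
    VectorFourier.fourierIntegral_continuous Real.continuous_fourierChar
      (by exact continuous_inner) h1
  refine ae_eq_of_integral_contDiff_smul_eq
    ((Lp.memLp (𝓕 (h2.toLp f) : HilbertSpace)).locallyIntegrable (by norm_num))
    hc.locallyIntegrable fun g hg hgs => ?_
  let G : SchwartzMap ℝ ℂ :=
    (hgs.comp_left (g := fun t : ℝ => (t : ℂ)) Complex.ofReal_zero).toSchwartzMap
      (Complex.ofRealCLM.contDiff.comp hg)
  have hG : ∀ x, G x = (g x : ℂ) := fun x => rfl
  -- The `L²` transform agrees with the one of tempered distributions, so both candidates satisfy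
  -- the same multiplication formula against test functions.
  have key : ∫ x, G x • (𝓕 (h2.toLp f) : HilbertSpace) x = ∫ x, (𝓕 G) x • (h2.toLp f) x := by
    rw [← Lp.toTemperedDistribution_apply, ← Lp.fourier_toTemperedDistribution_eq,
      TemperedDistribution.fourier_apply, Lp.toTemperedDistribution_apply]
  have e1 : ∫ x, (𝓕 G) x • (h2.toLp f) x = ∫ x, (𝓕 (G : ℝ → ℂ)) x • f x := by
    apply integral_congr_ae
    filter_upwards [h2.coeFn_toLp] with x hx
    rw [hx, SchwartzMap.fourier_coe]
  have e2 : ∫ x, (𝓕 (G : ℝ → ℂ)) x • f x = ∫ x, G x • (𝓕 f) x := by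
    simpa using! VectorFourier.integral_fourierIntegral_smul_eq_flip (L := innerₗ ℝ) (μ := volume)
      (ν := volume) Real.continuous_fourierChar (by exact continuous_inner) G.integrable h1
  rw [e1, e2] at key
  simpa [hG] using key

/-! ### Contour shifts in the strip `0 ≤ Im z ≤ π` -/

/-- A function which is holomorphic on the closed strip `0 ≤ Im z ≤ π` and decays quadratically. -/
structure StripDecay (F : ℂ → ℂ) : Prop where
  diff : ∀ z : ℂ, 0 ≤ z.im → z.im ≤ Real.pi → DifferentiableAt ℂ F z
  bound : ∃ C : ℝ, ∀ z : ℂ, 0 ≤ z.im → z.im ≤ Real.pi → ‖F z‖ ≤ C * (1 + z.re ^ 2)⁻¹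

namespace StripDecay

variable {F : ℂ → ℂ}

theorem mul_bounded (h : StripDecay F) {M : ℂ → ℂ} {C : ℝ}
    (hM : ∀ z : ℂ, 0 ≤ z.im → z.im ≤ Real.pi → DifferentiableAt ℂ M z)
    (hb : ∀ z : ℂ, 0 ≤ z.im → z.im ≤ Real.pi → ‖M z‖ ≤ C) :
    StripDecay fun z => M z * F z := by
  obtain ⟨D, hD⟩ := h.bound
  refine ⟨fun z h0 h1 => (hM z h0 h1).mul (h.diff z h0 h1), C * D, fun z h0 h1 => ?_⟩
  rw [norm_mul, mul_assoc]
  exact mul_le_mul (hb z h0 h1) (hD z h0 h1) (norm_nonneg _) ((norm_nonneg _).trans (hb z h0 h1))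

theorem continuous_line (h : StripDecay F) {y : ℝ} (h0 : 0 ≤ y) (h1 : y ≤ Real.pi) :
    Continuous fun x : ℝ => F (x + y * Complex.I) := by
  refine continuous_iff_continuousAt.2 fun x => ?_
  refine ContinuousAt.comp (g := F) (f := fun x : ℝ => (x : ℂ) + y * Complex.I)
    (h.diff _ (by simpa using h0) (by simpa using h1)).continuousAt ?_
  fun_prop

theorem exists_bound_line (h : StripDecay F) : ∃ C : ℝ, ∀ y : ℝ, 0 ≤ y → y ≤ Real.pi →
    ∀ x : ℝ, ‖F (x + y * Complex.I)‖ ≤ C * (1 + x ^ 2)⁻¹ := by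
  obtain ⟨C, hC⟩ := h.bound
  refine ⟨C, fun y h0 h1 x => ?_⟩
  simpa using hC (x + y * Complex.I) (by simpa using h0) (by simpa using h1)

theorem integrable_line (h : StripDecay F) {y : ℝ} (h0 : 0 ≤ y) (h1 : y ≤ Real.pi) :
    Integrable fun x : ℝ => F (x + y * Complex.I) := by
  obtain ⟨C, hC⟩ := h.exists_bound_line
  exact (integrable_inv_one_add_sq.const_mul C).mono'
    (h.continuous_line h0 h1).aestronglyMeasurable (ae_of_all _ (hC y h0 h1))

theorem memLp_line (h : StripDecay F) {y : ℝ} (h0 : 0 ≤ y) (h1 : y ≤ Real.pi) :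
    MemLp (fun x : ℝ => F (x + y * Complex.I)) 2 := by
  obtain ⟨C, hC⟩ := h.exists_bound_line
  have hi := h.integrable_line h0 h1
  have hb : ∀ x : ℝ, ‖F (x + y * Complex.I)‖ ≤ |C| := fun x => (hC y h0 h1 x).trans <| by
    have h2 : (1 + x ^ 2)⁻¹ ≤ 1 := inv_le_one_of_one_le₀ (by nlinarith [sq_nonneg x])
    have h3 : 0 ≤ (1 + x ^ 2)⁻¹ := by positivity
    calc C * (1 + x ^ 2)⁻¹ ≤ |C| * (1 + x ^ 2)⁻¹ := by gcongr; exact le_abs_self C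
      _ ≤ |C| * 1 := by gcongr
      _ = |C| := mul_one _
  refine (memLp_two_iff_integrable_sq_norm hi.aestronglyMeasurable).2 ?_
  refine (hi.norm.const_mul |C|).mono' (hi.aestronglyMeasurable.norm.pow 2) ?_
  refine ae_of_all _ fun x => ?_
  rw [Real.norm_of_nonneg (by positivity), sq]
  exact mul_le_mul_of_nonneg_right (hb x) (norm_nonneg _)

/-- Cauchy's theorem on the rectangles `[-T, T] × [0, π]`; the quadratic decay kills the vertical
sides as `T → ∞`. -/
theorem integral_eq (h : StripDecay F) :
    ∫ x : ℝ, F x = ∫ x : ℝ, F (x + Real.pi * Complex.I) := by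
  obtain ⟨C, hC⟩ := h.exists_bound_line
  have hpi := Real.pi_pos.le
  have hlim : ∀ y : ℝ, 0 ≤ y → y ≤ Real.pi →
      Tendsto (fun T : ℝ => ∫ x in (-T)..T, F (x + y * Complex.I)) atTop
        (𝓝 (∫ x : ℝ, F (x + y * Complex.I))) := fun y h0 h1 =>
    intervalIntegral_tendsto_integral (h.integrable_line h0 h1) tendsto_neg_atTop_atBot tendsto_id
  have hvert : ∀ s : ℝ → ℝ, (∀ T, s T ^ 2 = T ^ 2) →
      Tendsto (fun T : ℝ => ∫ y in (0 : ℝ)..Real.pi, F (s T + y * Complex.I)) atTop (𝓝 0) := by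
    intro s hs
    have hb : ∀ T : ℝ, ‖∫ y in (0 : ℝ)..Real.pi, F (s T + y * Complex.I)‖ ≤
        C * (1 + T ^ 2)⁻¹ * |Real.pi - 0| := fun T => by
      refine intervalIntegral.norm_integral_le_of_norm_le_const fun y hy => ?_
      rw [uIoc_of_le hpi] at hy
      simpa [hs] using hC y hy.1.le hy.2 (s T)
    refine squeeze_zero_norm hb ?_
    have : Tendsto (fun T : ℝ => (1 + T ^ 2)⁻¹) atTop (𝓝 0) :=
      tendsto_inv_atTop_zero.comp (tendsto_atTop_add_const_left _ _ (tendsto_pow_atTop two_ne_zero))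
    simpa using (this.const_mul C).mul_const |Real.pi - 0|
  have hrect : ∀ T : ℝ, (∫ x in (-T)..T, F (x + (0 : ℝ) * Complex.I)) -
      (∫ x in (-T)..T, F (x + Real.pi * Complex.I)) +
      Complex.I • (∫ y in (0 : ℝ)..Real.pi, F (T + y * Complex.I)) -
      Complex.I • (∫ y in (0 : ℝ)..Real.pi, F ((-T : ℝ) + y * Complex.I)) = 0 := by
    intro T
    have := Complex.integral_boundary_rect_eq_zero_of_differentiableOn F (-T : ℝ)
      (T + Real.pi * Complex.I) (fun z hz => by
        have hz2 := hz.2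
        simp only [Complex.ofReal_im, Complex.add_im, Complex.mul_im, Complex.ofReal_re,
          Complex.I_im, Complex.I_re, mul_one, mul_zero, add_zero, zero_add,
          mem_preimage, uIcc_of_le hpi] at hz2
        exact (h.diff z hz2.1 hz2.2).differentiableWithinAt)
    simpa using this
  have hl := (((hlim 0 le_rfl hpi).sub (hlim Real.pi hpi le_rfl)).add
    ((hvert (fun T => T) fun T => rfl).const_smul Complex.I)).sub
    ((hvert (fun T => -T) fun T => neg_sq T).const_smul Complex.I)
  have := tendsto_nhds_unique (hl.congr hrect) tendsto_const_nhds
  simpa [sub_eq_zero] using this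

/-- The contour shift is applied to `e^{-2πiξz} F(z)`: the exponential is bounded on the strip and
gains the factor `e^{2π²ξ}` on the upper line. -/
theorem fourier_line (h : StripDecay F) (ξ : ℝ) :
    𝓕 (fun x : ℝ => F (x + Real.pi * Complex.I)) ξ =
      Real.exp (-2 * Real.pi ^ 2 * ξ) * 𝓕 (fun x : ℝ => F x) ξ := by
  have hE : StripDecay fun z => Complex.exp (-2 * Real.pi * ξ * Complex.I * z) * F z := by
    refine h.mul_bounded (C := Real.exp (2 * Real.pi * |ξ| * Real.pi)) (fun z _ _ => by fun_prop)
      fun z h0 h1 => ?_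
    rw [Complex.norm_exp]
    apply Real.exp_le_exp.2
    have : (-2 * Real.pi * ξ * Complex.I * z).re = 2 * Real.pi * (ξ * z.im) := by
      simp; ring
    rw [this, mul_assoc (2 * Real.pi)]
    have : ξ * z.im ≤ |ξ| * Real.pi :=
      mul_le_mul (le_abs_self ξ) h1 h0 (abs_nonneg ξ)
    have := Real.pi_pos
    gcongr
  have := hE.integral_eq
  rw [Real.fourier_real_eq_integral_exp_smul, Real.fourier_real_eq_integral_exp_smul]
  have e1 : ∫ x : ℝ, Complex.exp (((-2 * Real.pi * x * ξ : ℝ) : ℂ) * Complex.I) • F x =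
      ∫ x : ℝ, Complex.exp (-2 * Real.pi * ξ * Complex.I * x) * F x := by
    congr 1 with x
    rw [smul_eq_mul]; congr 2; push_cast; ring
  rw [e1, this, ← integral_const_mul]
  congr 1 with x
  rw [smul_eq_mul, ← mul_assoc, Complex.ofReal_exp, ← Complex.exp_add]
  congr 2
  push_cast
  linear_combination (2 * Real.pi ^ 2 * ξ : ℂ) * Complex.I_sq

/-- The restriction to the lower boundary of the strip, as an element of `L²`. -/
def lower (h : StripDecay F) : HilbertSpace :=
  MemLp.toLp (fun x : ℝ => F x) (by simpa using h.memLp_line le_rfl Real.pi_pos.le)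

/-- The restriction to the upper boundary of the strip, as an element of `L²`. -/
def upper (h : StripDecay F) : HilbertSpace :=
  (h.memLp_line Real.pi_pos.le le_rfl).toLp fun x : ℝ => F (x + Real.pi * Complex.I)

theorem lower_coe (h : StripDecay F) : h.lower =ᵐ[volume] fun x : ℝ => F x := MemLp.coeFn_toLp _

theorem upper_coe (h : StripDecay F) :
    h.upper =ᵐ[volume] fun x : ℝ => F (x + Real.pi * Complex.I) := MemLp.coeFn_toLp _

theorem fourier_lower (h : StripDecay F) :
    (𝓕 h.lower : HilbertSpace) =ᵐ[volume] 𝓕 fun x : ℝ => F x :=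
  fourier_toLp_ae_eq (by simpa using h.integrable_line le_rfl Real.pi_pos.le) _

end StripDecay

theorem isModularPower_half_iff {ψ χ : HilbertSpace} : IsModularPower (1 / 2) ψ χ ↔
    (𝓕 χ : HilbertSpace) =ᵐ[volume]
      fun ξ : ℝ => (Real.exp (-2 * Real.pi ^ 2 * ξ) : ℂ) * (𝓕 ψ : HilbertSpace) ξ := by
  have : ∀ ξ : ℝ, Complex.exp (1 / 2 * ((-4 * Real.pi ^ 2 * ξ : ℝ) : ℂ)) =
      (Real.exp (-2 * Real.pi ^ 2 * ξ) : ℂ) := fun ξ => by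
    rw [Complex.ofReal_exp]; congr 1; push_cast; ring
  simp only [IsModularPower, this]

theorem StripDecay.isModularPower {F : ℂ → ℂ} (h : StripDecay F) :
    IsModularPower (1 / 2) h.lower h.upper := by
  rw [isModularPower_half_iff]
  filter_upwards [h.fourier_lower, fourier_toLp_ae_eq (h.integrable_line Real.pi_pos.le le_rfl)
    (h.memLp_line Real.pi_pos.le le_rfl)] with ξ h1 h2
  rw [h1, ← h.fourier_line, ← h2]
  rfl

theorem inner_eq_integral_conj_mul (f g : HilbertSpace) :
    ⟪f, g⟫_ℂ = ∫ x, conj (f x) * g x := by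
  rw [L2.inner_def]
  congr 1 with x
  rw [RCLike.inner_apply, mul_comm]

/-- `Δ^{1/2}` is symmetric, since in Fourier space it is multiplication by a real function. -/
theorem IsModularPower.inner_comm {g g' ψ χ : HilbertSpace} (hg : IsModularPower (1 / 2) g g')
    (h : IsModularPower (1 / 2) ψ χ) : ⟪g, χ⟫_ℂ = ⟪g', ψ⟫_ℂ := by
  rw [isModularPower_half_iff] at hg h
  rw [← Lp.inner_fourier_eq g, ← Lp.inner_fourier_eq g', inner_eq_integral_conj_mul,
    inner_eq_integral_conj_mul]
  apply integral_congr_ae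
  filter_upwards [hg, h] with ξ h1 h2
  rw [h1, h2, map_mul, Complex.conj_ofReal]
  ring

/-! ### Vectors of the standard subspace -/

theorem modularConj_modularConj (ψ : HilbertSpace) : modularConj (modularConj ψ) = ψ :=
  star_star ψ

theorem mem_standardSubspace_iff {ψ : HilbertSpace} :
    ψ ∈ standardSubspace ↔ IsModularPower (1 / 2) ψ (modularConj ψ) := by
  constructor
  · rintro ⟨χ, h, rfl⟩
    rwa [modularConj_modularConj]
  · exact fun h => ⟨_, h, modularConj_modularConj ψ⟩

theorem inner_modularConj_modularConj (ψ χ : HilbertSpace) :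
    ⟪modularConj ψ, modularConj χ⟫_ℂ = conj ⟪ψ, χ⟫_ℂ := by
  rw [inner_eq_integral_conj_mul, inner_eq_integral_conj_mul, ← integral_conj]
  apply integral_congr_ae
  filter_upwards [modularConj_coe ψ, modularConj_coe χ] with θ h1 h2
  rw [h1, h2, map_mul]

theorem StripDecay.upper_eq_modularConj {F : ℂ → ℂ} (h : StripDecay F)
    (hs : ∀ x : ℝ, F (x + Real.pi * Complex.I) = conj (F x)) :
    h.upper = modularConj h.lower := by
  apply Lp.ext
  filter_upwards [h.upper_coe, h.lower_coe, modularConj_coe h.lower] with θ h1 h2 h3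
  rw [h1, h3, h2, hs]

theorem StripDecay.lower_mem {F : ℂ → ℂ} (h : StripDecay F)
    (hs : ∀ x : ℝ, F (x + Real.pi * Complex.I) = conj (F x)) :
    h.lower ∈ standardSubspace := by
  rw [mem_standardSubspace_iff, ← h.upper_eq_modularConj hs]
  exact h.isModularPower

/-- The inclusion `JH ⊆ H'`: for `η, ψ ∈ H`, symmetry of `Δ^{1/2}` gives `⟪η, Jψ⟫ = ⟪Jη, ψ⟫`, and
antiunitarity of `J` makes the right side the conjugate of the left. -/
theorem modularConj_mem_symplecticComplement {ψ : HilbertSpace} (hψ : ψ ∈ standardSubspace) :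
    modularConj ψ ∈ symplecticComplement standardSubspace := by
  intro η hη
  rw [mem_standardSubspace_iff] at hψ hη
  have h := hη.inner_comm hψ
  rw [← modularConj_modularConj ψ, inner_modularConj_modularConj, modularConj_modularConj] at h
  exact Complex.conj_eq_iff_im.1 h.symm

/-! ### Gaussian vectors -/

/-- Gaussians which are symmetric with respect to the reflection of the strip. -/
def gaussian (w : ℝ) (z : ℂ) : ℂ :=
  Complex.exp (-Real.pi * (z - Real.pi / 2 * Complex.I) ^ 2 +
    2 * Real.pi * w * (z - Real.pi / 2 * Complex.I))

theorem stripDecay_gaussian (w : ℝ) : StripDecay (gaussian w) := by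
  refine ⟨fun z _ _ => by unfold gaussian; fun_prop,
    Real.exp (Real.pi ^ 3 + Real.pi ^ 2 * w ^ 2), fun z h0 h1 => ?_⟩
  have hpi := Real.pi_gt_three
  have hre : (-Real.pi * (z - Real.pi / 2 * Complex.I) ^ 2 +
      2 * Real.pi * w * (z - Real.pi / 2 * Complex.I)).re =
      -Real.pi * (z.re ^ 2 - (z.im - Real.pi / 2) ^ 2) + 2 * Real.pi * w * z.re := by
    rw [Complex.add_re, sq]
    simp [Complex.mul_re, Complex.mul_im]
    ring
  have h2 : (z.im - Real.pi / 2) ^ 2 ≤ Real.pi ^ 2 := by nlinarith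
  -- Completing the square: what remains is `(x - πw)² + (π - 2)x² ≥ 0` with `x = Re z`.
  have h3 : -Real.pi * (z.re ^ 2 - (z.im - Real.pi / 2) ^ 2) + 2 * Real.pi * w * z.re ≤
      Real.pi ^ 3 + Real.pi ^ 2 * w ^ 2 - z.re ^ 2 := by
    nlinarith [sq_nonneg (z.re - Real.pi * w), mul_le_mul_of_nonneg_left h2 (by linarith : 0 ≤ Real.pi),
      mul_nonneg (by linarith : 0 ≤ Real.pi - 2) (sq_nonneg z.re)]
  rw [gaussian, Complex.norm_exp, hre]
  refine (Real.exp_le_exp.2 h3).trans ?_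
  rw [Real.exp_sub, div_eq_mul_inv]
  gcongr
  linarith [Real.add_one_le_exp (z.re ^ 2)]

theorem gaussian_symm (w x : ℝ) :
    gaussian w (x + Real.pi * Complex.I) = conj (gaussian w x) := by
  rw [gaussian, gaussian, ← Complex.exp_conj]
  congr 1
  simp only [map_add, map_mul, map_neg, map_sub, map_pow, map_div₀, Complex.conj_ofReal,
    Complex.conj_I, map_ofNat]
  ring

theorem fourier_gaussian (w ξ : ℝ) : 𝓕 (fun x : ℝ => gaussian w x) ξ =
    Complex.exp (Real.pi ^ 3 / 4 - Real.pi ^ 2 * w * Complex.I) *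
      Complex.exp (-Real.pi * (ξ - Real.pi / 2 + w * Complex.I) ^ 2) := by
  have key := congrFun (fourier_gaussian_pi' (b := 1) (by simp) (w + Real.pi / 2 * Complex.I)) ξ
  rw [Real.fourier_real_eq_integral_exp_smul] at key ⊢
  have e : ∀ x : ℝ, gaussian w x =
      Complex.exp (Real.pi ^ 3 / 4 - Real.pi ^ 2 * w * Complex.I) *
        Complex.exp (-Real.pi * 1 * x ^ 2 + 2 * Real.pi * (w + Real.pi / 2 * Complex.I) * x) := by
    intro x
    rw [gaussian, ← Complex.exp_add]
    congr 1
    linear_combination (-Real.pi ^ 3 / 4 : ℂ) * Complex.I_sq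
  simp only [e, smul_eq_mul, mul_left_comm _ (Complex.exp (Real.pi ^ 3 / 4 - _))] at key ⊢
  rw [integral_const_mul, key]
  have e' : ξ + Complex.I * (w + Real.pi / 2 * Complex.I) = ξ - Real.pi / 2 + w * Complex.I := by
    linear_combination (Real.pi / 2 : ℂ) * Complex.I_sq
  simp only [Complex.one_cpow, div_one, one_mul, e']

theorem integrable_gaussian_shift (s : ℝ) :
    Integrable fun ξ : ℝ => Real.exp (-Real.pi * (ξ + s) ^ 2) :=
  (integrable_exp_neg_mul_sq Real.pi_pos).comp_add_right s

theorem memLp_gaussian_mul (s : ℝ) (f : HilbertSpace) :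
    MemLp (fun ξ : ℝ => (Real.exp (-Real.pi * (ξ + s) ^ 2) : ℂ) * f ξ) 2 := by
  refine (Lp.memLp f).of_le (AEStronglyMeasurable.mul ?_ (Lp.aestronglyMeasurable f))
    (ae_of_all _ fun ξ => ?_)
  · exact Continuous.aestronglyMeasurable (by fun_prop)
  · rw [norm_mul, Complex.norm_real, Real.norm_of_nonneg (Real.exp_pos _).le]
    refine mul_le_of_le_one_left (norm_nonneg _) (Real.exp_le_one_iff.2 ?_)
    have := mul_nonneg Real.pi_pos.le (sq_nonneg (ξ + s))
    linarith

theorem integrable_gaussian_mul (s : ℝ) (f : HilbertSpace) :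
    Integrable fun ξ : ℝ => (Real.exp (-Real.pi * (ξ + s) ^ 2) : ℂ) * f ξ := by
  refine MemLp.integrable_mul (p := 2) (q := 2) ?_ (Lp.memLp f)
  refine (memLp_two_iff_integrable_sq_norm
    (Continuous.aestronglyMeasurable (by fun_prop))).2 ?_
  refine (integrable_gaussian_shift s).mono' (Continuous.aestronglyMeasurable (by fun_prop))
    (ae_of_all _ fun ξ => ?_)
  have h1 : Real.exp (-Real.pi * (ξ + s) ^ 2) ≤ 1 := Real.exp_le_one_iff.2 (by
    have := mul_nonneg Real.pi_pos.le (sq_nonneg (ξ + s))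
    linarith)
  have h0 := (Real.exp_pos (-Real.pi * (ξ + s) ^ 2)).le
  rw [Complex.norm_real, Real.norm_of_nonneg (by positivity), Real.norm_of_nonneg h0, sq]
  exact mul_le_of_le_one_left h0 h1

/-- Gaussian vectors determine the graph of `Δ^{1/2}`. -/
theorem isModularPower_of_inner_gaussian {ψ χ : HilbertSpace}
    (h : ∀ w : ℝ, ⟪(stripDecay_gaussian w).lower, χ⟫_ℂ =
      ⟪modularConj (stripDecay_gaussian w).lower, ψ⟫_ℂ) :
    IsModularPower (1 / 2) ψ χ := by
  -- The two Gaussians differ by the factor `e^{-2π²ξ}`, so `v` is a Gaussian times `𝓕χ - e^{-2π²ξ}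
  -- 𝓕ψ`. Written this way, each term is integrable and square integrable without knowing that `ψ`
  -- lies in the domain of `Δ^{1/2}`.
  set v : ℝ → ℂ := fun ξ =>
    (Real.exp (-Real.pi * (ξ + -(Real.pi / 2)) ^ 2) : ℂ) * (𝓕 χ : HilbertSpace) ξ -
      (Real.exp (-Real.pi * (ξ + Real.pi / 2) ^ 2) : ℂ) * (𝓕 ψ : HilbertSpace) ξ with hv
  have hexp : ∀ ξ : ℝ, Real.exp (-Real.pi * (ξ + Real.pi / 2) ^ 2) =
      Real.exp (-Real.pi * (ξ + -(Real.pi / 2)) ^ 2) * Real.exp (-2 * Real.pi ^ 2 * ξ) :=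
    fun ξ => by rw [← Real.exp_add]; congr 1; ring
  have hv1 : Integrable v := (integrable_gaussian_mul _ _).sub (integrable_gaussian_mul _ _)
  have hv2 : MemLp v 2 := (memLp_gaussian_mul _ _).sub (memLp_gaussian_mul _ _)
  -- The parameter `w` enters the Fourier transform of the Gaussian vector as a modulation, up to a
  -- nonzero constant. The hypothesis for all `w` thus says that the Fourier transform of `v`
  -- vanishes.
  have hF : ∀ w : ℝ, 𝓕 v (-w) = 0 := by
    intro w
    have hw := h w
    have hM := (stripDecay_gaussian w).isModularPower
    rw [(stripDecay_gaussian w).upper_eq_modularConj (gaussian_symm w),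
      isModularPower_half_iff] at hM
    rw [← Lp.inner_fourier_eq _ χ, ← Lp.inner_fourier_eq _ ψ, inner_eq_integral_conj_mul,
      inner_eq_integral_conj_mul] at hw
    obtain ⟨c, hc⟩ : ∃ c : ℂ,
        c = Complex.exp (Real.pi ^ 3 / 4 - Real.pi ^ 2 * w * Complex.I) := ⟨_, rfl⟩
    obtain ⟨d, hd⟩ : ∃ d : ℂ, d = conj c *
        Complex.exp (Real.pi * w ^ 2 - Real.pi ^ 2 * w * Complex.I) := ⟨_, rfl⟩
    have hd0 : d ≠ 0 := by
      rw [hd, hc, ← Complex.exp_conj]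
      exact mul_ne_zero (Complex.exp_ne_zero _) (Complex.exp_ne_zero _)
    have hg : ∀ ξ : ℝ, conj (c * Complex.exp (-Real.pi * (ξ - Real.pi / 2 + w * Complex.I) ^ 2)) =
        d * (Complex.exp (((-2 * Real.pi * ξ * -w : ℝ) : ℂ) * Complex.I) *
          (Real.exp (-Real.pi * (ξ + -(Real.pi / 2)) ^ 2) : ℂ)) := by
      intro ξ
      rw [map_mul, hd, mul_assoc, ← Complex.exp_conj, Complex.ofReal_exp, ← Complex.exp_add,
        ← Complex.exp_add]
      congr 2
      simp only [map_add, map_mul, map_neg, map_sub, map_pow, map_div₀, Complex.conj_ofReal,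
        Complex.conj_I, map_ofNat, Complex.ofReal_mul, Complex.ofReal_neg, Complex.ofReal_add,
        Complex.ofReal_pow, Complex.ofReal_div, Complex.ofReal_ofNat]
      linear_combination (-Real.pi * w ^ 2 : ℂ) * Complex.I_sq
    have i1 : Integrable fun ξ : ℝ => Complex.exp (((-2 * Real.pi * ξ * -w : ℝ) : ℂ) * Complex.I) *
        ((Real.exp (-Real.pi * (ξ + -(Real.pi / 2)) ^ 2) : ℂ) * (𝓕 χ : HilbertSpace) ξ) := by
      refine (integrable_gaussian_mul _ (𝓕 χ : HilbertSpace)).bdd_mul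
        (Continuous.aestronglyMeasurable (by fun_prop)) (c := 1) (ae_of_all _ fun ξ => ?_)
      rw [Complex.norm_exp_ofReal_mul_I]
    have i2 : Integrable fun ξ : ℝ => Complex.exp (((-2 * Real.pi * ξ * -w : ℝ) : ℂ) * Complex.I) *
        ((Real.exp (-Real.pi * (ξ + Real.pi / 2) ^ 2) : ℂ) * (𝓕 ψ : HilbertSpace) ξ) := by
      refine (integrable_gaussian_mul _ (𝓕 ψ : HilbertSpace)).bdd_mul
        (Continuous.aestronglyMeasurable (by fun_prop)) (c := 1) (ae_of_all _ fun ξ => ?_)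
      rw [Complex.norm_exp_ofReal_mul_I]
    have e1 : ∫ ξ, conj ((𝓕 (stripDecay_gaussian w).lower : HilbertSpace) ξ) *
        (𝓕 χ : HilbertSpace) ξ =
        d * ∫ ξ : ℝ, Complex.exp (((-2 * Real.pi * ξ * -w : ℝ) : ℂ) * Complex.I) *
        ((Real.exp (-Real.pi * (ξ + -(Real.pi / 2)) ^ 2) : ℂ) * (𝓕 χ : HilbertSpace) ξ) := by
      rw [← integral_const_mul]
      apply integral_congr_ae
      filter_upwards [(stripDecay_gaussian w).fourier_lower] with ξ h1
      rw [h1, fourier_gaussian, ← hc, hg]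
      ring
    have e2 : ∫ ξ, conj ((𝓕 (modularConj (stripDecay_gaussian w).lower) : HilbertSpace) ξ) *
        (𝓕 ψ : HilbertSpace) ξ =
        d * ∫ ξ : ℝ, Complex.exp (((-2 * Real.pi * ξ * -w : ℝ) : ℂ) * Complex.I) *
        ((Real.exp (-Real.pi * (ξ + Real.pi / 2) ^ 2) : ℂ) * (𝓕 ψ : HilbertSpace) ξ) := by
      rw [← integral_const_mul]
      apply integral_congr_ae
      filter_upwards [(stripDecay_gaussian w).fourier_lower, hM] with ξ h1 h2
      rw [h2, h1, fourier_gaussian, ← hc, map_mul, Complex.conj_ofReal, hg, hexp ξ]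
      push_cast
      ring
    rw [e1, e2] at hw
    rw [Real.fourier_real_eq_integral_exp_smul]
    simp only [hv, smul_eq_mul, mul_sub]
    rw [integral_sub i1 i2, mul_left_cancel₀ hd0 hw, sub_self]
  have hv0 : v =ᵐ[volume] 0 := by
    have h1 : (𝓕 (hv2.toLp v) : HilbertSpace) = 0 := by
      apply Lp.ext
      filter_upwards [fourier_toLp_ae_eq hv1 hv2, Lp.coeFn_zero ℂ 2 (volume : Measure ℝ)]
        with ξ h2 h3
      rw [h2, h3, ← neg_neg ξ, hF, Pi.zero_apply]
    have h2 : hv2.toLp v = 0 := by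
      rw [← norm_eq_zero, ← Lp.norm_fourier_eq, h1, norm_zero]
    exact (hv2.coeFn_toLp.symm.trans (by rw [h2])).trans (Lp.coeFn_zero ℂ 2 volume)
  rw [isModularPower_half_iff]
  filter_upwards [hv0] with ξ hξ
  have h3 : (Real.exp (-Real.pi * (ξ + -(Real.pi / 2)) ^ 2) : ℂ) ≠ 0 := by
    exact_mod_cast (Real.exp_pos _).ne'
  refine mul_left_cancel₀ h3 ?_
  simp only [hv, Pi.zero_apply, sub_eq_zero] at hξ
  rw [hξ, hexp]
  push_cast
  ring

/-- The standard subspace is stable under multiplication by bounded symmetric holomorphic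
functions on the strip. -/
theorem mul_mem_standardSubspace {M : ℂ → ℂ} {C : ℝ}
    (hM : ∀ z : ℂ, 0 ≤ z.im → z.im ≤ Real.pi → DifferentiableAt ℂ M z)
    (hb : ∀ z : ℂ, 0 ≤ z.im → z.im ≤ Real.pi → ‖M z‖ ≤ C)
    (hs : ∀ x : ℝ, M (x + Real.pi * Complex.I) = conj (M x))
    {ψ χ : HilbertSpace} (hψ : ψ ∈ standardSubspace)
    (hχ : χ =ᵐ[volume] fun θ : ℝ => M θ * ψ θ) : χ ∈ standardSubspace := by
  rw [mem_standardSubspace_iff] at hψ ⊢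
  refine isModularPower_of_inner_gaussian fun w => ?_
  have hF := (stripDecay_gaussian w).mul_bounded hM hb
  -- The multiplier is moved onto the Gaussian: `M` times a Gaussian is again holomorphic, decaying
  -- and symmetric on the strip.
  have key := hF.isModularPower.inner_comm hψ
  rw [hF.upper_eq_modularConj fun x => by rw [hs, gaussian_symm, map_mul]] at key
  have e1 : ⟪(stripDecay_gaussian w).lower, modularConj χ⟫_ℂ = ⟪hF.lower, modularConj ψ⟫_ℂ := by
    rw [inner_eq_integral_conj_mul, inner_eq_integral_conj_mul]
    apply integral_congr_ae
    filter_upwards [modularConj_coe χ, modularConj_coe ψ, hχ, hF.lower_coe,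
      (stripDecay_gaussian w).lower_coe] with θ h1 h2 h3 h4 h5
    rw [h1, h2, h3, h4, h5, map_mul, map_mul]
    ring
  have e2 : ⟪modularConj (stripDecay_gaussian w).lower, χ⟫_ℂ = ⟪modularConj hF.lower, ψ⟫_ℂ := by
    rw [inner_eq_integral_conj_mul, inner_eq_integral_conj_mul]
    apply integral_congr_ae
    filter_upwards [modularConj_coe (stripDecay_gaussian w).lower, modularConj_coe hF.lower, hχ,
      hF.lower_coe, (stripDecay_gaussian w).lower_coe] with θ h1 h2 h3 h4 h5
    rw [h1, h2, h3, h4, h5, Complex.conj_conj, Complex.conj_conj]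
    ring
  rw [e1, e2, key]

/-- The standard subspace is a factor: `H ∩ H' = {0}`. -/
theorem eq_zero_of_mem_of_mem_symplecticComplement {ψ : HilbertSpace}
    (h : ψ ∈ standardSubspace) (h' : ψ ∈ symplecticComplement standardSubspace) : ψ = 0 := by
  -- Membership in `H'` yields `Δ^{1/2} Jψ = ψ`; with `Δ^{1/2} ψ = Jψ` this gives `Δψ = ψ`. The
  -- multiplier of `Δ` equals `1` only at `ξ = 0`, a null set, so `ψ = 0`.
  have h2 : IsModularPower (1 / 2) (modularConj ψ) ψ := by
    refine isModularPower_of_inner_gaussian fun w => ?_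
    rw [inner_modularConj_modularConj]
    exact (Complex.conj_eq_iff_im.2
      (h' _ ((stripDecay_gaussian w).lower_mem (gaussian_symm w)))).symm
  rw [mem_standardSubspace_iff] at h
  rw [isModularPower_half_iff] at h h2
  have h0 : (𝓕 ψ : HilbertSpace) = 0 := by
    apply Lp.ext
    have hne : ∀ᵐ ξ : ℝ, ξ ≠ 0 := by simp [ae_iff, measure_singleton]
    filter_upwards [h, h2, hne, Lp.coeFn_zero ℂ 2 (volume : Measure ℝ)] with ξ h3 h4 h5 h6
    rw [h6, Pi.zero_apply]
    rw [h3, ← mul_assoc, ← Complex.ofReal_mul, ← Real.exp_add] at h4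
    by_contra h7
    have h8 := mul_right_cancel₀ h7 ((one_mul _).trans h4)
    have h9 : Real.exp (-2 * Real.pi ^ 2 * ξ + -2 * Real.pi ^ 2 * ξ) = 1 := by exact_mod_cast h8.symm
    rw [Real.exp_eq_one_iff] at h9
    have : Real.pi ^ 2 * ξ = 0 := by linarith
    simp [Real.pi_ne_zero, h5] at this
  rw [← norm_eq_zero, ← Lp.norm_fourier_eq, h0, norm_zero]

/-! ### The outer part of the example -/

/-- The function `A(p) = e^{iνp} s_{ν,-q}(p) = (e^{2iνp - q} - e^q) / 2`, which is bounded with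
bounded inverse on the upper half plane. -/
def outerPart (ν q : ℝ) (p : ℂ) : ℂ :=
  (Complex.exp (2 * Complex.I * ν * p - q) - Complex.exp q) / 2

theorem sinFun_eq_exp_sub_exp (ν q : ℝ) (p : ℂ) : sinFun ν q p =
    (Complex.exp (Complex.I * ν * p + q) - Complex.exp (-(Complex.I * ν * p + q))) / 2 := by
  have e : (ν * p - Complex.I * q) * Complex.I = Complex.I * ν * p + q := by
    linear_combination (-q : ℂ) * Complex.I_sq
  rw [sinFun, Complex.sin, neg_mul, e]
  linear_combination ((Complex.exp (-(Complex.I * ν * p + q)) -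
    Complex.exp (Complex.I * ν * p + q)) / 2) * Complex.I_sq

theorem sinFun_neg_eq (ν q : ℝ) (p : ℂ) :
    sinFun ν (-q) p = Complex.exp (-(Complex.I * ν * p)) * outerPart ν q p := by
  rw [sinFun_eq_exp_sub_exp, outerPart, mul_div_assoc', mul_sub, ← Complex.exp_add,
    ← Complex.exp_add]
  push_cast
  ring_nf

theorem sinFun_eq (ν q : ℝ) (p : ℂ) :
    sinFun ν q p = -(Complex.exp (Complex.I * ν * p) * outerPart ν q (-p)) := by
  rw [sinFun_eq_exp_sub_exp, outerPart, mul_div_assoc', mul_sub, ← Complex.exp_add,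
    ← Complex.exp_add]
  ring_nf

/-- This isolates the translation `e^{2iνp}`. On the real line `A(-p)` is `conj A(p)`, so the
remaining quotient is unimodular there. -/
theorem sinRatio_eq (ν q : ℝ) (p : ℂ) : sinRatio ν q p =
    -(Complex.exp (2 * Complex.I * ν * p) * outerPart ν q (-p)) / outerPart ν q p := by
  have : Complex.exp (2 * Complex.I * ν * p) =
      Complex.exp (Complex.I * ν * p) * Complex.exp (Complex.I * ν * p) := by
    rw [← Complex.exp_add]; ring_nf
  rw [sinRatio, sinFun_eq, sinFun_neg_eq, Complex.exp_neg, this, ← div_div, neg_div,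
    div_inv_eq_mul]
  ring

theorem differentiable_outerPart (ν q : ℝ) : Differentiable ℂ (outerPart ν q) := by
  unfold outerPart
  fun_prop

theorem outerPart_neg_conj (ν q : ℝ) (p : ℂ) :
    outerPart ν q (-conj p) = conj (outerPart ν q p) := by
  simp only [outerPart, map_div₀, map_sub, ← Complex.exp_conj, map_mul, Complex.conj_ofReal,
    Complex.conj_I, map_ofNat]
  ring_nf

theorem outerPart_neg_ofReal (ν q p : ℝ) :
    outerPart ν q (-(p : ℂ)) = conj (outerPart ν q p) := by
  rw [← outerPart_neg_conj, Complex.conj_ofReal]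

section bounds

variable {ν q : ℝ}

theorem norm_exp_outerPart (p : ℂ) :
    ‖Complex.exp (2 * Complex.I * ν * p - q)‖ = Real.exp (-(2 * ν * p.im) - q) := by
  rw [Complex.norm_exp]
  congr 1
  simp

theorem sinh_le_norm_outerPart (hν : 0 < ν) {p : ℂ} (hp : 0 ≤ p.im) :
    Real.sinh q ≤ ‖outerPart ν q p‖ := by
  have h1 : Real.exp (-(2 * ν * p.im) - q) ≤ Real.exp (-q) :=
    Real.exp_le_exp.2 (by have := mul_nonneg hν.le hp; linarith)
  have h2 := norm_sub_norm_le (Complex.exp q) (Complex.exp (2 * Complex.I * ν * p - q))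
  rw [norm_exp_outerPart, Complex.norm_exp_ofReal, norm_sub_rev] at h2
  rw [outerPart, norm_div, Complex.norm_ofNat, Real.sinh_eq]
  linarith

theorem norm_outerPart_le (hν : 0 < ν) {p : ℂ} (hp : 0 ≤ p.im) :
    ‖outerPart ν q p‖ ≤ Real.cosh q := by
  have h1 : Real.exp (-(2 * ν * p.im) - q) ≤ Real.exp (-q) :=
    Real.exp_le_exp.2 (by have := mul_nonneg hν.le hp; linarith)
  have h2 := norm_sub_le (Complex.exp (2 * Complex.I * ν * p - q)) (Complex.exp q)
  rw [norm_exp_outerPart, Complex.norm_exp_ofReal] at h2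
  rw [outerPart, norm_div, Complex.norm_ofNat, Real.cosh_eq]
  linarith

theorem outerPart_ne_zero (hν : 0 < ν) (hq : 0 < q) {p : ℂ} (hp : 0 ≤ p.im) :
    outerPart ν q p ≠ 0 :=
  norm_pos_iff.1 ((Real.sinh_pos_iff.2 hq).trans_le (sinh_le_norm_outerPart hν hp))

theorem differentiableAt_sinRatio (hν : 0 < ν) (hq : 0 < q) {p : ℂ} (hp : 0 ≤ p.im) :
    DifferentiableAt ℂ (sinRatio ν q) p := by
  have : sinRatio ν q = fun p => -(Complex.exp (2 * Complex.I * ν * p) * outerPart ν q (-p)) /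
      outerPart ν q p := funext (sinRatio_eq ν q)
  rw [this]
  refine DifferentiableAt.div ?_ (differentiable_outerPart ν q p) (outerPart_ne_zero hν hq hp)
  refine (DifferentiableAt.mul (by fun_prop) ?_).neg
  exact (differentiable_outerPart ν q).differentiableAt.comp p differentiable_neg.differentiableAt

theorem tendsto_add_mul_I {φ : ℂ → ℂ} {p : ℂ} (h : ContinuousAt φ p) :
    Tendsto (fun ε : ℝ => φ (p + ε * Complex.I)) (𝓝[>] 0) (𝓝 (φ p)) := by
  have h2 : Tendsto (fun ε : ℝ => p + ε * Complex.I) (𝓝 0) (𝓝 (p + (0 : ℝ) * Complex.I)) :=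
    Continuous.tendsto (by fun_prop) 0
  rw [Complex.ofReal_zero, zero_mul, add_zero] at h2
  exact h.tendsto.comp (h2.mono_left nhdsWithin_le_nhds)

theorem boundaryValue_sinRatio (hν : 0 < ν) (hq : 0 < q) (p : ℝ) :
    boundaryValue (sinRatio ν q) p = sinRatio ν q p :=
  (tendsto_add_mul_I
    (differentiableAt_sinRatio hν hq (p := (p : ℂ)) (by simp)).continuousAt).limUnder_eq

end bounds

/-! ### Multiplication by functions of the momentum -/

theorem im_exp_nonneg {z : ℂ} (h0 : 0 ≤ z.im) (h1 : z.im ≤ Real.pi) : 0 ≤ (Complex.exp z).im := by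
  rw [Complex.exp_im]
  exact mul_nonneg (Real.exp_pos _).le (Real.sin_nonneg_of_nonneg_of_le_pi h0 h1)

theorem exp_add_pi_mul_I_ofReal (x : ℝ) :
    Complex.exp (x + Real.pi * Complex.I) = -((Real.exp x : ℝ) : ℂ) := by
  rw [Complex.exp_add, Complex.exp_pi_mul_I, Complex.ofReal_exp, mul_neg_one]

/-- The standard subspace is stable under multiplication by bounded symmetric holomorphic functions
of the momentum. -/
theorem comp_exp_mul_mem_standardSubspace {N : ℂ → ℂ} {C : ℝ}
    (hN : ∀ p : ℂ, 0 ≤ p.im → DifferentiableAt ℂ N p) (hb : ∀ p : ℂ, 0 ≤ p.im → ‖N p‖ ≤ C)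
    (hs : ∀ p : ℝ, N (-(p : ℂ)) = conj (N p))
    {ψ χ : HilbertSpace} (hψ : ψ ∈ standardSubspace)
    (hχ : χ =ᵐ[volume] fun θ : ℝ => N (Real.exp θ : ℝ) * ψ θ) : χ ∈ standardSubspace := by
  refine mul_mem_standardSubspace (M := fun z => N (Complex.exp z)) (C := C)
    (fun z h0 h1 => ?_) (fun z h0 h1 => hb _ (im_exp_nonneg h0 h1)) (fun x => ?_) hψ ?_
  · exact (hN _ (im_exp_nonneg h0 h1)).comp z Complex.differentiableAt_exp
  · rw [exp_add_pi_mul_I_ofReal, hs, Complex.ofReal_exp]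
  · simpa only [Complex.ofReal_exp] using hχ

theorem memLp_mul_of_bound {m : ℝ → ℂ} {C : ℝ} (hm : Continuous m) (hb : ∀ θ, ‖m θ‖ ≤ C)
    (f : HilbertSpace) : MemLp (fun θ => m θ * f θ) 2 := by
  refine (Lp.memLp f).of_le_mul (c := C)
    (hm.aestronglyMeasurable.mul (Lp.aestronglyMeasurable f)) (ae_of_all _ fun θ => ?_)
  rw [norm_mul]
  exact mul_le_mul_of_nonneg_right (hb θ) (norm_nonneg _)

theorem continuous_comp_exp {N : ℂ → ℂ} (hN : ∀ p : ℂ, 0 ≤ p.im → DifferentiableAt ℂ N p) :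
    Continuous fun θ : ℝ => N (Real.exp θ : ℝ) := by
  refine continuous_iff_continuousAt.2 fun θ => ?_
  refine ContinuousAt.comp (g := N) (f := fun θ : ℝ => ((Real.exp θ : ℝ) : ℂ))
    (hN _ (by simp)).continuousAt ?_
  fun_prop

theorem norm_exp_I_mul_le_one {c : ℝ} (hc : 0 ≤ c) {p : ℂ} (hp : 0 ≤ p.im) :
    ‖Complex.exp (Complex.I * c * p)‖ ≤ 1 := by
  rw [Complex.norm_exp, Real.exp_le_one_iff]
  have := mul_nonneg hc hp
  simpa using this

theorem translation_ne_zero (a θ : ℝ) : translation a θ ≠ 0 := Complex.exp_ne_zero _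

/-! ### Triviality of the local subspaces of small intervals -/

theorem localSubspace_eq_bot {ν q r : ℝ} (hν : 0 < ν) (hq : 0 < q) (hr : r ≤ ν) :
    localSubspace (sinRatio ν q) (-r) r = ⊥ := by
  rw [eq_bot_iff]
  rintro ψ ⟨⟨χ, ⟨h, hh, h1⟩, h2⟩, h', hh', h3⟩
  have hsinh : 0 < Real.sinh q := Real.sinh_pos_iff.2 hq
  have hinv : ∀ p : ℂ, 0 ≤ p.im → DifferentiableAt ℂ (fun p => (outerPart ν q p)⁻¹) p :=
    fun p hp => (differentiable_outerPart ν q p).inv (outerPart_ne_zero hν hq hp)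
  have hinvb : ∀ p : ℂ, 0 ≤ p.im → ‖(outerPart ν q p)⁻¹‖ ≤ (Real.sinh q)⁻¹ := fun p hp => by
    rw [norm_inv]
    exact inv_anti₀ hsinh (sinh_le_norm_outerPart hν hp)
  have hinvs : ∀ p : ℝ, (outerPart ν q (-(p : ℂ)))⁻¹ = conj ((outerPart ν q p)⁻¹) := fun p => by
    rw [outerPart_neg_ofReal, map_inv₀]
  -- Bounded on the upper half plane because `r ≤ ν` makes the exponential a forward translation.
  set N : ℂ → ℂ := fun p =>
    Complex.exp (Complex.I * (2 * (ν - r) : ℝ) * p) * (outerPart ν q p)⁻¹ with hNdef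
  have hN : ∀ p : ℂ, 0 ≤ p.im → DifferentiableAt ℂ N p := fun p hp =>
    DifferentiableAt.mul (by fun_prop) (hinv p hp)
  have hNb : ∀ p : ℂ, 0 ≤ p.im → ‖N p‖ ≤ 1 * (Real.sinh q)⁻¹ := fun p hp => by
    rw [hNdef, norm_mul]
    exact mul_le_mul (norm_exp_I_mul_le_one (by linarith) hp) (hinvb p hp) (norm_nonneg _)
      zero_le_one
  have hNs : ∀ p : ℝ, N (-(p : ℂ)) = conj (N p) := fun p => by
    simp only [hNdef]
    rw [hinvs, map_mul, ← Complex.exp_conj]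
    simp only [map_mul, Complex.conj_I, Complex.conj_ofReal, mul_neg, neg_mul]
  have hu := memLp_mul_of_bound (continuous_comp_exp hN) (fun θ => hNb _ (by simp)) h
  set u : HilbertSpace := hu.toLp _ with hudef
  have hu' : u =ᵐ[volume] fun θ : ℝ => N (Real.exp θ : ℝ) * h θ := hu.coeFn_toLp
  have huH : u ∈ standardSubspace := comp_exp_mul_mem_standardSubspace hN hNb hNs hh hu'
  have hrel : ∀ᵐ θ : ℝ, u θ = -((conj (outerPart ν q (Real.exp θ : ℝ)))⁻¹ * h' θ) := by
    filter_upwards [hu', h1, h2, h3] with θ h4 h5 h6 h7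
    rw [h4]
    have hA : outerPart ν q (Real.exp θ : ℝ) ≠ 0 := outerPart_ne_zero hν hq (by simp)
    have hA' : conj (outerPart ν q (Real.exp θ : ℝ)) ≠ 0 := by simpa using hA
    have h8 : translation r θ * h' θ = translation (-r) θ * (sinRatio ν q (Real.exp θ : ℝ) * h θ) := by
      rw [← h7, h6, h5, boundaryValue_sinRatio hν hq]
    have h9 : h' θ = -(Complex.exp (Complex.I * (2 * (ν - r) : ℝ) * (Real.exp θ : ℝ)) *
        conj (outerPart ν q (Real.exp θ : ℝ)) * (outerPart ν q (Real.exp θ : ℝ))⁻¹ * h θ) := by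
      refine mul_left_cancel₀ (translation_ne_zero r θ) ?_
      rw [h8, sinRatio_eq, outerPart_neg_ofReal, div_eq_mul_inv]
      have h10 : translation r θ *
          Complex.exp (Complex.I * (2 * (ν - r) : ℝ) * (Real.exp θ : ℝ)) =
          translation (-r) θ * Complex.exp (2 * Complex.I * ν * (Real.exp θ : ℝ)) := by
        simp only [translation]
        rw [← Complex.exp_add, ← Complex.exp_add]
        congr 1
        push_cast
        ring
      linear_combination (-conj (outerPart ν q (Real.exp θ : ℝ)) *
        (outerPart ν q (Real.exp θ : ℝ))⁻¹ * h θ) * h10.symm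
    rw [h9, hNdef]
    field_simp
  -- By `hrel`, `⟪η, u⟫ = -⟪A⁻¹η, h'⟫`, and `A⁻¹η` is again in `H`.
  have huH' : u ∈ symplecticComplement standardSubspace := by
    intro η hη
    have hm := memLp_mul_of_bound (continuous_comp_exp hinv) (fun θ => hinvb _ (by simp)) η
    have hmem := comp_exp_mul_mem_standardSubspace hinv hinvb hinvs hη hm.coeFn_toLp
    have e : ⟪η, u⟫_ℂ = -⟪hm.toLp _, h'⟫_ℂ := by
      rw [inner_eq_integral_conj_mul, inner_eq_integral_conj_mul, ← integral_neg]
      apply integral_congr_ae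
      filter_upwards [hrel, hm.coeFn_toLp] with θ h4 h5
      rw [h4, h5, map_mul, map_inv₀]
      ring
    rw [e, Complex.neg_im, hh' _ hmem, neg_zero]
  have hu0 := eq_zero_of_mem_of_mem_symplecticComplement huH huH'
  rw [Submodule.mem_bot]
  apply Lp.ext
  filter_upwards [hrel, h3, Lp.coeFn_zero ℂ 2 (volume : Measure ℝ)] with θ h4 h5 h6
  have hA : outerPart ν q (Real.exp θ : ℝ) ≠ 0 := outerPart_ne_zero hν hq (by simp)
  rw [hu0, h6, Pi.zero_apply, zero_eq_neg, mul_eq_zero, inv_eq_zero, map_eq_zero] at h4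
  rw [h5, h6, h4.resolve_left hA, mul_zero, Pi.zero_apply]

/-! ### Nontriviality of the local subspaces of large intervals -/

theorem norm_exp_sub_one_le_two_mul {w : ℂ} (hw : ‖Complex.exp w‖ ≤ 1) :
    ‖Complex.exp w - 1‖ ≤ 2 * ‖w‖ := by
  rcases le_total ‖w‖ 1 with h | h
  · exact Complex.norm_exp_sub_one_le h
  · have := norm_sub_le (Complex.exp w) 1
    rw [norm_one] at this
    linarith

/-- The momentum space function `i (e^{icp} - 1)² / p`. -/
def kernel (c : ℝ) (p : ℂ) : ℂ := Complex.I * (Complex.exp (Complex.I * c * p) - 1) ^ 2 / p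

theorem conj_kernel (c p : ℝ) : conj (kernel c p) =
    -(Complex.exp (-(2 * Complex.I * c * p)) * kernel c p) := by
  have h : Complex.exp (-(2 * Complex.I * c * p)) =
      Complex.exp (-(Complex.I * c * p)) * Complex.exp (-(Complex.I * c * p)) := by
    rw [← Complex.exp_add]; ring_nf
  simp only [kernel, map_div₀, map_mul, map_pow, map_sub, map_one, ← Complex.exp_conj,
    Complex.conj_I, Complex.conj_ofReal, neg_mul]
  rw [h]
  have h2 : Complex.exp (-(Complex.I * c * p)) * Complex.exp (Complex.I * c * p) = 1 := by
    rw [← Complex.exp_add]; simp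
  generalize Complex.exp (-(Complex.I * c * p)) = a at *
  generalize Complex.exp (Complex.I * c * p) = b at *
  have h3 : (a - 1) ^ 2 = a * a * (b - 1) ^ 2 := by
    linear_combination (2 * a - a * b - 1) * h2
  rw [h3]
  ring

theorem kernel_neg (c p : ℝ) : kernel c (-(p : ℂ)) = conj (kernel c p) := by
  simp only [kernel, map_div₀, map_mul, map_pow, map_sub, map_one, ← Complex.exp_conj,
    Complex.conj_I, Complex.conj_ofReal, div_neg, neg_mul, mul_neg, neg_div]

/-- The numerator is bounded and vanishes to second order at `p = 0`, so the kernel is `O(1/|p|)`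
for large and `O(|p|)` for small `p`. With `|p| = e^{Re z}` this is exponential decay in both
directions of the strip. -/
theorem stripDecay_kernel {c : ℝ} (hc : 0 < c) : StripDecay fun z => kernel c (Complex.exp z) := by
  refine ⟨fun z _ _ => ?_, 8 + 8 * c ^ 2, fun z h0 h1 => ?_⟩
  · unfold kernel
    exact DifferentiableAt.div (by fun_prop) Complex.differentiableAt_exp (Complex.exp_ne_zero z)
  have hp := im_exp_nonneg h0 h1
  have hn : ‖Complex.exp z‖ = Real.exp z.re := Complex.norm_exp z
  generalize Complex.exp z = p at hp hn
  have hppos : 0 < ‖p‖ := hn ▸ Real.exp_pos _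
  have he := norm_exp_I_mul_le_one hc.le hp
  have b1 : ‖Complex.exp (Complex.I * c * p) - 1‖ ≤ 2 := by
    have := norm_sub_le (Complex.exp (Complex.I * c * p)) 1
    rw [norm_one] at this
    linarith
  have b2 : ‖Complex.exp (Complex.I * c * p) - 1‖ ≤ 2 * (c * ‖p‖) := by
    have := norm_exp_sub_one_le_two_mul he
    rwa [norm_mul, norm_mul, Complex.norm_I, one_mul, Complex.norm_real,
      Real.norm_of_nonneg hc.le] at this
  have hk : ‖kernel c p‖ = ‖Complex.exp (Complex.I * c * p) - 1‖ ^ 2 / ‖p‖ := by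
    rw [kernel, norm_div, norm_mul, Complex.norm_I, one_mul, norm_pow]
  have hexp : ∀ t : ℝ, 0 ≤ t → Real.exp (-t) ≤ 2 * (1 + t ^ 2)⁻¹ := fun t ht => by
    rw [Real.exp_neg, ← div_eq_mul_inv, le_div_iff₀ (by positivity), ← div_eq_inv_mul,
      div_le_iff₀ (Real.exp_pos t)]
    nlinarith [Real.quadratic_le_exp_of_nonneg ht]
  have hinv : 0 ≤ (1 + z.re ^ 2)⁻¹ := by positivity
  rw [hk]
  rcases le_total 0 z.re with h | h
  · have h2 : ‖Complex.exp (Complex.I * c * p) - 1‖ ^ 2 / ‖p‖ ≤ 2 ^ 2 / ‖p‖ := by gcongr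
    have h3 : (2 : ℝ) ^ 2 / ‖p‖ = 4 * Real.exp (-z.re) := by
      rw [hn, Real.exp_neg]; ring
    nlinarith [hexp z.re h, mul_nonneg (sq_nonneg c) hinv]
  · have h2 : ‖Complex.exp (Complex.I * c * p) - 1‖ ^ 2 / ‖p‖ ≤ (2 * (c * ‖p‖)) ^ 2 / ‖p‖ := by
      gcongr
    have h3 : (2 * (c * ‖p‖)) ^ 2 / ‖p‖ = 4 * c ^ 2 * Real.exp (- -z.re) := by
      rw [neg_neg, ← hn]; field_simp; ring
    have h4 := hexp (-z.re) (by linarith)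
    rw [neg_sq] at h4
    have h5 := mul_le_mul_of_nonneg_left h4 (by positivity : 0 ≤ 4 * c ^ 2)
    nlinarith

theorem localSubspace_ne_bot {ν q r : ℝ} (hν : 0 < ν) (hq : 0 < q) (hr : ν < r) :
    localSubspace (sinRatio ν q) (-r) r ≠ ⊥ := by
  have hc : 0 < r - ν := sub_pos.2 hr
  have hF : StripDecay fun z => outerPart ν q (Complex.exp z) * kernel (r - ν) (Complex.exp z) :=
    (stripDecay_kernel hc).mul_bounded
      (fun z _ _ => ((differentiable_outerPart ν q).comp Complex.differentiable_exp) z)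
      (fun z h0 h1 => norm_outerPart_le hν (im_exp_nonneg h0 h1))
  have hlow : hF.lower =ᵐ[volume] fun θ : ℝ =>
      outerPart ν q (Real.exp θ : ℝ) * kernel (r - ν) (Real.exp θ : ℝ) := by
    simpa only [Complex.ofReal_exp] using hF.lower_coe
  have hmem : hF.lower ∈ standardSubspace := hF.lower_mem fun x => by
    rw [exp_add_pi_mul_I_ofReal, outerPart_neg_ofReal, kernel_neg, map_mul, Complex.ofReal_exp]
  have htr : ∀ a θ : ℝ, ‖translation a θ‖ ≤ 1 := fun a θ => by
    rw [translation, Complex.norm_exp]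
    simp
  have htc : ∀ a : ℝ, Continuous (translation a) := fun a => by unfold translation; fun_prop
  have hψ := memLp_mul_of_bound (htc r) (htr r) (modularConj hF.lower)
  have hχ := memLp_mul_of_bound ((htc r).mul (htc r))
    (fun θ => (norm_mul_le _ _).trans (mul_le_one₀ (htr r θ) (norm_nonneg _) (htr r θ)))
    (modularConj hF.lower)
  intro hbot
  have hin : hψ.toLp _ ∈ localSubspace (sinRatio ν q) (-r) r := by
    refine ⟨⟨hχ.toLp _, ⟨hF.lower, hmem, ?_⟩, ?_⟩,
      modularConj hF.lower, modularConj_mem_symplecticComplement hmem, hψ.coeFn_toLp⟩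
    · filter_upwards [hχ.coeFn_toLp, hlow, modularConj_coe hF.lower] with θ h1 h2 h3
      have hA : outerPart ν q (Real.exp θ : ℝ) ≠ 0 := outerPart_ne_zero hν hq (by simp)
      rw [h1, h3, h2, boundaryValue_sinRatio hν hq, sinRatio_eq, outerPart_neg_ofReal, map_mul,
        conj_kernel, Pi.mul_apply]
      have h4 : translation r θ * translation r θ *
          Complex.exp (-(2 * Complex.I * (r - ν : ℝ) * (Real.exp θ : ℝ))) =
          Complex.exp (2 * Complex.I * ν * (Real.exp θ : ℝ)) := by
        simp only [translation]
        rw [← Complex.exp_add, ← Complex.exp_add]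
        congr 1
        push_cast
        ring
      rw [← h4]
      field_simp
    · filter_upwards [hψ.coeFn_toLp, hχ.coeFn_toLp] with θ h1 h2
      rw [h1, h2, Pi.mul_apply]
      have h4 : translation (-r) θ * translation r θ = 1 := by
        simp only [translation]
        rw [← Complex.exp_add]
        simp
      linear_combination (-translation r θ * modularConj hF.lower θ) * h4
  rw [hbot, Submodule.mem_bot] at hin
  have hcont : Continuous fun x : ℝ =>
      outerPart ν q (Complex.exp x) * kernel (r - ν) (Complex.exp x) := by
    simpa using hF.continuous_line le_rfl Real.pi_pos.le
  have hzero : (fun x : ℝ => outerPart ν q (Complex.exp x) * kernel (r - ν) (Complex.exp x)) =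
      fun _ => 0 := by
    refine (hcont.ae_eq_iff_eq volume continuous_const).1 ?_
    have h0 := hψ.coeFn_toLp
    rw [hin] at h0
    filter_upwards [h0, hF.lower_coe, modularConj_coe hF.lower,
      Lp.coeFn_zero ℂ 2 (volume : Measure ℝ)] with θ h1 h2 h3 h4
    rw [h4, h3, h2, Pi.zero_apply] at h1
    simpa [translation_ne_zero] using h1.symm
  -- At `p = π/(r - ν)` one has `e^{i(r-ν)p} = -1`, so the kernel takes the nonzero value `4i/p`.
  have h1 := congrFun hzero (Real.log (Real.pi / (r - ν)))
  have h2 : Complex.exp (Real.log (Real.pi / (r - ν)) : ℝ) = ((Real.pi / (r - ν) : ℝ) : ℂ) := by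
    rw [← Complex.ofReal_exp, Real.exp_log (div_pos Real.pi_pos hc)]
  simp only [h2] at h1
  refine mul_ne_zero (outerPart_ne_zero hν hq (Complex.ofReal_im _).ge) ?_ h1
  have hc' : ((r - ν : ℝ) : ℂ) ≠ 0 := by exact_mod_cast hc.ne'
  have h3 : Complex.I * (r - ν : ℝ) * ((Real.pi / (r - ν) : ℝ) : ℂ) = Real.pi * Complex.I := by
    rw [Complex.ofReal_div]
    field_simp
  rw [kernel, h3, Complex.exp_pi_mul_I]
  refine div_ne_zero (mul_ne_zero Complex.I_ne_zero (by norm_num)) ?_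
  exact_mod_cast (div_pos Real.pi_pos hc).ne'

theorem localizationRadius_sinRatio {ν q : ℝ} (hν : 0 < ν) (hq : 0 < q) :
    localizationRadius (sinRatio ν q) = ENNReal.ofReal ν := by
  apply le_antisymm
  · refine ENNReal.le_of_forall_pos_le_add fun ε hε _ => ?_
    have h : localSubspace (sinRatio ν q) (-((ν.toNNReal + ε : ℝ≥0) : ℝ)) (ν.toNNReal + ε : ℝ≥0) ≠ ⊥ :=
      localSubspace_ne_bot hν hq (by
        rw [NNReal.coe_add, Real.coe_toNNReal ν hν.le]
        exact lt_add_of_pos_right ν hε)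
    exact iInf₂_le (ν.toNNReal + ε) h
  · refine le_iInf₂ fun r hr => ?_
    by_contra hlt
    refine hr (localSubspace_eq_bot hν hq ?_)
    rw [not_le] at hlt
    rw [ENNReal.ofReal, ENNReal.coe_lt_coe] at hlt
    have := NNReal.coe_lt_coe.2 hlt
    rw [Real.coe_toNNReal ν hν.le] at this
    exact this.le

/-! ### Convergence of Blaschke products -/

theorem isOpen_upperHalf : IsOpen upperHalf := isOpen_lt continuous_const Complex.continuous_im

open Classical in
/-- The unimodular convergence factor of a Blaschke product. -/
def convFactor (a : ℂ) : ℂ := if a = Complex.I then 1 else (‖1 + a ^ 2‖ : ℂ) / (1 + a ^ 2)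

theorem blaschkeFactor_eq (a p : ℂ) :
    blaschkeFactor a p = convFactor a * ((p - a) / (p - conj a)) := rfl

theorem add_I_ne_zero {a : ℂ} (ha : 0 < a.im) : a + Complex.I ≠ 0 := fun h => by
  have := congrArg Complex.im h
  simp at this
  linarith

theorem one_add_sq_eq (a : ℂ) : 1 + a ^ 2 = (a - Complex.I) * (a + Complex.I) := by
  linear_combination Complex.I_sq

theorem one_add_sq_ne_zero {a : ℂ} (ha : 0 < a.im) (hI : a ≠ Complex.I) : 1 + a ^ 2 ≠ 0 := by
  rw [one_add_sq_eq]
  exact mul_ne_zero (sub_ne_zero.2 hI) (add_I_ne_zero ha)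

theorem norm_convFactor {a : ℂ} (ha : 0 < a.im) : ‖convFactor a‖ = 1 := by
  unfold convFactor
  split_ifs with h
  · exact norm_one
  · rw [norm_div, Complex.norm_real, norm_norm,
      div_self (norm_ne_zero_iff.2 (one_add_sq_ne_zero ha h))]

theorem sub_conj_ne_zero {a p : ℂ} (ha : 0 < a.im) (hp : 0 < p.im) : p - conj a ≠ 0 := fun h => by
  have := congrArg Complex.im h
  simp at this
  linarith

theorem norm_conj_sub_I (a : ℂ) : ‖Complex.I - conj a‖ = ‖a + Complex.I‖ := by
  rw [← Complex.norm_conj, map_sub, Complex.conj_I, Complex.conj_conj, ← norm_neg]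
  congr 1
  ring

/-- The convergence factor serves to make the Blaschke factor real and nonnegative at `i`; its
distance from `1` there is then controlled by its modulus alone. -/
theorem blaschkeFactor_I {a : ℂ} (ha : 0 < a.im) :
    blaschkeFactor a Complex.I = ((‖a - Complex.I‖ / ‖a + Complex.I‖ : ℝ) : ℂ) := by
  rw [blaschkeFactor_eq, convFactor]
  split_ifs with h
  · simp [h]
  · have h1 : a - Complex.I ≠ 0 := sub_ne_zero.2 h
    have h2 := add_I_ne_zero ha
    have h3 : conj (a + Complex.I) ≠ 0 := (map_ne_zero _).2 h2
    have h4 : Complex.I - conj a = -conj (a + Complex.I) := by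
      rw [map_add, Complex.conj_I]; ring
    have h5 : (a + Complex.I) * conj (a + Complex.I) = (‖a + Complex.I‖ : ℂ) ^ 2 :=
      Complex.mul_conj' _
    have h6 : (‖a + Complex.I‖ : ℂ) ≠ 0 := by simpa using h2
    rw [one_add_sq_eq, norm_mul, h4, Complex.ofReal_mul, Complex.ofReal_div]
    field_simp
    linear_combination (‖a - Complex.I‖ * (a - Complex.I) : ℂ) * h5.symm

theorem norm_add_I_sq (a : ℂ) : ‖a + Complex.I‖ ^ 2 = ‖a - Complex.I‖ ^ 2 + 4 * a.im := by
  rw [Complex.sq_norm, Complex.sq_norm, Complex.normSq_apply, Complex.normSq_apply]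
  simp
  ring

theorem one_add_norm_sq_le {a : ℂ} (ha : 0 < a.im) : 1 + ‖a‖ ^ 2 ≤ ‖a + Complex.I‖ ^ 2 := by
  rw [Complex.sq_norm, Complex.sq_norm, Complex.normSq_apply, Complex.normSq_apply]
  simp
  nlinarith

theorem norm_blaschkeFactor_sub_one_le {a p : ℂ} {δ R : ℝ} (ha : 0 < a.im) (hδ : 0 < δ)
    (hp : δ ≤ p.im) (hR : ‖Complex.I - p‖ ≤ R) :
    ‖blaschkeFactor a p - 1‖ ≤ (4 + 2 * R * (R / δ + 1)) * (a.im / (1 + ‖a‖ ^ 2)) := by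
  have hp0 : 0 < p.im := hδ.trans_le hp
  have hR0 : 0 ≤ R := (norm_nonneg _).trans hR
  set N := ‖a + Complex.I‖ with hN
  have hNpos : 0 < N := norm_pos_iff.2 (add_I_ne_zero ha)
  have hsq := norm_add_I_sq a
  have hsum : blaschkeFactor a p - 1 = (blaschkeFactor a Complex.I - 1) +
      convFactor a * ((p - a) / (p - conj a) - (Complex.I - a) / (Complex.I - conj a)) := by
    rw [blaschkeFactor_eq, blaschkeFactor_eq]; ring
  have h1 : ‖blaschkeFactor a Complex.I - 1‖ ≤ 4 * (a.im / N ^ 2) := by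
    rw [blaschkeFactor_I ha, ← Complex.ofReal_one, ← Complex.ofReal_sub, Complex.norm_real,
      Real.norm_eq_abs, abs_sub_comm, ← hN]
    have hle : ‖a - Complex.I‖ ≤ N := by
      refine le_of_sq_le_sq ?_ hNpos.le
      linarith
    rw [abs_of_nonneg (sub_nonneg.2 ((div_le_one hNpos).2 hle)), mul_div_assoc',
      le_div_iff₀ (by positivity)]
    have : (1 - ‖a - Complex.I‖ / N) * N ^ 2 = N ^ 2 - ‖a - Complex.I‖ * N := by
      field_simp
    rw [this]
    nlinarith [norm_nonneg (a - Complex.I)]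
  have h2 : ‖(p - a) / (p - conj a) - (Complex.I - a) / (Complex.I - conj a)‖ ≤
      2 * R * (R / δ + 1) * (a.im / N ^ 2) := by
    have hc1 := sub_conj_ne_zero ha hp0
    have hc2 : Complex.I - conj a ≠ 0 := sub_conj_ne_zero ha (by simp)
    have e : (p - a) / (p - conj a) - (Complex.I - a) / (Complex.I - conj a) =
        -((a - conj a) * (Complex.I - p) / ((p - conj a) * (Complex.I - conj a))) := by
      field_simp
      ring
    have hb : δ ≤ ‖p - conj a‖ := by
      have := Complex.abs_im_le_norm (p - conj a)
      rw [Complex.sub_im, Complex.conj_im, sub_neg_eq_add, abs_of_pos (by linarith)] at this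
      linarith
    have hNle : N ≤ (R / δ + 1) * ‖p - conj a‖ := by
      have h3 : N ≤ ‖Complex.I - p‖ + ‖p - conj a‖ := by
        rw [hN, ← norm_conj_sub_I, ← sub_add_sub_cancel Complex.I p (conj a)]
        exact norm_add_le _ _
      have h4 : R ≤ R / δ * ‖p - conj a‖ := by
        calc R = R / δ * δ := by field_simp
          _ ≤ _ := by gcongr
      linarith
    have him : ‖a - conj a‖ = 2 * a.im := by
      rw [Complex.sub_conj, norm_mul, Complex.norm_I, mul_one, Complex.norm_real,
        Real.norm_of_nonneg (by linarith)]
    rw [e, norm_neg, norm_div, norm_mul, norm_mul, him, norm_conj_sub_I, ← hN,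
      div_le_iff₀ (mul_pos (hδ.trans_le hb) hNpos)]
    calc 2 * a.im * ‖Complex.I - p‖ ≤ 2 * a.im * R := by gcongr
      _ = 2 * R * (a.im / N ^ 2) * (N * N) := by field_simp
      _ ≤ 2 * R * (a.im / N ^ 2) * ((R / δ + 1) * ‖p - conj a‖ * N) := by gcongr
      _ = _ := by ring
  have h3 : a.im / N ^ 2 ≤ a.im / (1 + ‖a‖ ^ 2) := by
    have := one_add_norm_sq_le ha
    gcongr
  rw [hsum]
  calc _ ≤ 4 * (a.im / N ^ 2) + 1 * (2 * R * (R / δ + 1) * (a.im / N ^ 2)) := by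
        refine (norm_add_le _ _).trans (add_le_add h1 ?_)
        rw [norm_mul, norm_convFactor ha]
        gcongr
    _ = (4 + 2 * R * (R / δ + 1)) * (a.im / N ^ 2) := by ring
    _ ≤ _ := by gcongr

/-- Blaschke products converge locally uniformly on the upper half plane. -/
theorem hasProdLocallyUniformlyOn_blaschkeFactor {ι : Type*} {a : ι → ℂ} (ha : ∀ i, 0 < (a i).im)
    (hs : Summable fun i => (a i).im / (1 + ‖a i‖ ^ 2)) :
    HasProdLocallyUniformlyOn (fun i p => blaschkeFactor (a i) p)
      (fun p => ∏' i, blaschkeFactor (a i) p) upperHalf := by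
  refine hasProdLocallyUniformlyOn_of_forall_compact isOpen_upperHalf fun K hK hKc => ?_
  rcases K.eq_empty_or_nonempty with rfl | hne
  · rw [hasProdUniformlyOn_iff_tendstoUniformlyOn]
    exact tendstoUniformlyOn_empty
  obtain ⟨p₀, hp₀, hmin⟩ := hKc.exists_isMinOn hne Complex.continuous_im.continuousOn
  obtain ⟨p₁, hp₁, hmax⟩ := hKc.exists_isMaxOn hne
    (f := fun p => ‖Complex.I - p‖) (by fun_prop)
  have key := Summable.hasProdUniformlyOn_one_add (f := fun i p => blaschkeFactor (a i) p - 1) hKc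
    (hs.mul_left (4 + 2 * ‖Complex.I - p₁‖ * (‖Complex.I - p₁‖ / p₀.im + 1)))
    (Eventually.of_forall fun i p hp =>
      norm_blaschkeFactor_sub_one_le (ha i) (hK hp₀) (hmin hp) (hmax hp))
    (fun i => ?_)
  · simpa only [add_sub_cancel] using key
  · simp only [blaschkeFactor_eq]
    exact (continuousOn_const.mul ((by fun_prop : ContinuousOn (fun p => p - a i) K).div
      (by fun_prop) fun p hp => sub_conj_ne_zero (ha i) (hK hp))).sub continuousOn_const

/-! ### The zeros of the example -/

/-- The zeros of `s_{ν,q}`. -/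
def sinZero (ν q : ℝ) (n : ℤ) : ℂ := (Real.pi * n + Complex.I * q) / ν

section zeros

variable {ν q : ℝ}

theorem sinZero_eq (ν q : ℝ) (n : ℤ) :
    sinZero ν q n = ((Real.pi * n / ν : ℝ) : ℂ) + ((q / ν : ℝ) : ℂ) * Complex.I := by
  rw [sinZero]; push_cast; ring

theorem sinZero_re (ν q : ℝ) (n : ℤ) : (sinZero ν q n).re = Real.pi * n / ν := by
  rw [sinZero_eq]; simp only [Complex.add_re, Complex.ofReal_re, Complex.re_ofReal_mul,
    Complex.I_re, mul_zero, add_zero]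

theorem sinZero_im (ν q : ℝ) (n : ℤ) : (sinZero ν q n).im = q / ν := by
  rw [sinZero_eq]; simp only [Complex.add_im, Complex.ofReal_im, Complex.im_ofReal_mul,
    Complex.I_im, mul_one, zero_add]

theorem sinZero_neg (ν q : ℝ) (n : ℤ) : sinZero ν q (-n) = -conj (sinZero ν q n) := by
  apply Complex.ext
  · rw [Complex.neg_re, Complex.conj_re, sinZero_re, sinZero_re]; push_cast; ring
  · rw [Complex.neg_im, Complex.conj_im, sinZero_im, sinZero_im, neg_neg]

theorem sinZero_injective (hν : 0 < ν) : Function.Injective (sinZero ν q) := by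
  intro m n h
  have := congrArg Complex.re h
  rw [sinZero_re, sinZero_re, div_left_inj' hν.ne', mul_right_inj' Real.pi_ne_zero] at this
  exact_mod_cast this

theorem sinFun_neg_ne_zero (hν : 0 < ν) (hq : 0 < q) {p : ℂ} (hp : 0 ≤ p.im) :
    sinFun ν (-q) p ≠ 0 := by
  rw [sinFun_neg_eq]
  exact mul_ne_zero (Complex.exp_ne_zero _) (outerPart_ne_zero hν hq hp)

theorem sinFun_eq_zero_iff (hν : 0 < ν) {p : ℂ} :
    sinFun ν q p = 0 ↔ ∃ n : ℤ, sinZero ν q n = p := by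
  have hν' : (ν : ℂ) ≠ 0 := by exact_mod_cast hν.ne'
  rw [sinFun, mul_eq_zero, or_iff_right Complex.I_ne_zero, Complex.sin_eq_zero_iff]
  refine exists_congr fun n => ?_
  rw [sinZero, div_eq_iff hν', sub_eq_iff_eq_add]
  constructor <;> intro h <;> linear_combination -h

theorem sinRatio_eq_zero_iff (hν : 0 < ν) (hq : 0 < q) {p : ℂ} (hp : 0 ≤ p.im) :
    sinRatio ν q p = 0 ↔ ∃ n : ℤ, sinZero ν q n = p := by
  rw [sinRatio, div_eq_zero_iff, or_iff_left (sinFun_neg_ne_zero hν hq hp), sinFun_eq_zero_iff hν]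

theorem sinZero_im_pos (hν : 0 < ν) (hq : 0 < q) (n : ℤ) : 0 < (sinZero ν q n).im := by
  rw [sinZero_im]
  exact div_pos hq hν

/-- The zeros of the example in the upper half plane are indexed by the integers. -/
def zerosEquiv (hν : 0 < ν) (hq : 0 < q) : ℤ ≃ zeros (sinRatio ν q) :=
  Equiv.ofBijective
    (fun n => ⟨sinZero ν q n, sinZero_im_pos hν hq n,
      (sinRatio_eq_zero_iff hν hq (sinZero_im_pos hν hq n).le).2 ⟨n, rfl⟩⟩)
    ⟨fun _ _ h => sinZero_injective hν (congrArg Subtype.val h), fun ⟨p, hp, h⟩ => by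
      obtain ⟨n, rfl⟩ := (sinRatio_eq_zero_iff hν hq hp.le).1 h
      exact ⟨n, rfl⟩⟩

@[simp] theorem zerosEquiv_coe (hν : 0 < ν) (hq : 0 < q) (n : ℤ) :
    (zerosEquiv hν hq n : ℂ) = sinZero ν q n := rfl

theorem mult_sinRatio (hν : 0 < ν) (hq : 0 < q) (a : zeros (sinRatio ν q)) :
    mult (sinRatio ν q) a = 1 := by
  obtain ⟨n, rfl⟩ := (zerosEquiv hν hq).surjective a
  have him := sinZero_im_pos hν hq n
  have hν' : (ν : ℂ) ≠ 0 := by exact_mod_cast hν.ne'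
  have han : AnalyticAt ℂ (sinRatio ν q) (sinZero ν q n) :=
    DifferentiableOn.analyticAt (s := upperHalf)
      (fun p hp => (differentiableAt_sinRatio hν hq (le_of_lt hp)).differentiableWithinAt)
      (isOpen_upperHalf.mem_nhds him)
  have hd : ∀ (q' : ℝ) (p : ℂ), HasDerivAt (sinFun ν q')
      (Complex.I * (Complex.cos (ν * p - Complex.I * q') * ν)) p := fun q' p =>
    (((hasDerivAt_mul_const (ν : ℂ)).congr_of_eventuallyEq
      (Eventually.of_forall fun x => mul_comm _ _)).sub_const (Complex.I * q')).csin.const_mul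
        Complex.I
  have hzero : sinFun ν q (sinZero ν q n) = 0 := (sinFun_eq_zero_iff hν).2 ⟨n, rfl⟩
  have hsin : Complex.sin (ν * sinZero ν q n - Complex.I * q) = 0 := by
    simpa [sinFun] using hzero
  have hcos : Complex.cos (ν * sinZero ν q n - Complex.I * q) ≠ 0 := fun h => by
    have := Complex.sin_sq_add_cos_sq (ν * sinZero ν q n - Complex.I * q)
    simp [hsin, h] at this
  have hden := sinFun_neg_ne_zero hν hq him.le
  have hderiv := (hd q (sinZero ν q n)).div (hd (-q) (sinZero ν q n)) hden
  have hne : deriv (sinRatio ν q) (sinZero ν q n) ≠ 0 := by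
    have e : sinRatio ν q = sinFun ν q / sinFun ν (-q) := rfl
    rw [e, hderiv.deriv, hzero, zero_mul, sub_zero]
    exact div_ne_zero (mul_ne_zero (mul_ne_zero Complex.I_ne_zero (mul_ne_zero hcos hν')) hden)
      (pow_ne_zero 2 hden)
  rw [mult, analyticOrderNatAt, zerosEquiv_coe, han.analyticOrderAt_eq_one_of_zero_deriv_ne_zero
    ((sinRatio_eq_zero_iff hν hq him.le).2 ⟨n, rfl⟩) hne]
  rfl

/-! ### The convergence exponent -/

theorem summable_zeros_rpow_iff (hν : 0 < ν) (hq : 0 < q) (α : ℝ) :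
    (Summable fun a : zeros (sinRatio ν q) =>
      (mult (sinRatio ν q) a : ℝ) * ‖(a : ℂ)‖ ^ (-α)) ↔
      Summable fun n : ℤ => ‖sinZero ν q n‖ ^ (-α) := by
  rw [← (zerosEquiv hν hq).summable_iff]
  simp [Function.comp_def, mult_sinRatio hν hq]

theorem summable_sinZero_rpow (hν : 0 < ν) {α : ℝ} (hα : 1 < α) :
    Summable fun n : ℤ => ‖sinZero ν q n‖ ^ (-α) := by
  refine ((Real.summable_abs_int_rpow hα).mul_left ((Real.pi / ν) ^ (-α))).of_norm_bounded_eventually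
    ?_
  -- The comparison fails at `n = 0`, where the real power `0 ^ (-α)` has the value `0`.
  filter_upwards [(Set.finite_singleton (0 : ℤ)).compl_mem_cofinite] with n hn
  have hn' : (0 : ℝ) < |(n : ℝ)| := by simpa using hn
  have hc : 0 < Real.pi / ν := div_pos Real.pi_pos hν
  have h1 : Real.pi / ν * |(n : ℝ)| ≤ ‖sinZero ν q n‖ := by
    have := Complex.abs_re_le_norm (sinZero ν q n)
    rwa [sinZero_re, abs_div, abs_mul, abs_of_pos Real.pi_pos, abs_of_pos hν, mul_div_right_comm]
      at this
  rw [Real.norm_of_nonneg (by positivity), ← Real.mul_rpow hc.le hn'.le]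
  exact Real.rpow_le_rpow_of_nonpos (mul_pos hc hn') h1 (by linarith)

theorem not_summable_sinZero_rpow (hν : 0 < ν) (hq : 0 < q) {α : ℝ} (h0 : 0 ≤ α) (hα : α ≤ 1) :
    ¬ Summable fun n : ℤ => ‖sinZero ν q n‖ ^ (-α) := by
  intro h
  have hc : 0 < (Real.pi + q) / ν := div_pos (add_pos Real.pi_pos hq) hν
  have h2 : Summable fun n : ℕ => ((Real.pi + q) / ν) ^ (-α) * (n : ℝ) ^ (-α) := by
    refine Summable.of_norm_bounded_eventually (h.comp_injective Nat.cast_injective) ?_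
    filter_upwards [(Set.finite_singleton (0 : ℕ)).compl_mem_cofinite] with n hn
    have hn' : (1 : ℝ) ≤ n := by
      exact_mod_cast Nat.one_le_iff_ne_zero.2 hn
    have h1 : ‖sinZero ν q n‖ ≤ (Real.pi + q) / ν * n := by
      refine (Complex.norm_le_abs_re_add_abs_im _).trans ?_
      rw [sinZero_re, sinZero_im, Int.cast_natCast, abs_of_nonneg (by positivity),
        abs_of_pos (by positivity), ← add_div, div_mul_eq_mul_div]
      gcongr
      nlinarith
    have hpos : 0 < ‖sinZero ν q n‖ :=
      norm_pos_iff.2 fun h => (sinZero_im_pos hν hq n).ne' (by rw [h]; rfl)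
    rw [← Real.mul_rpow hc.le (by positivity), Real.norm_of_nonneg (by positivity)]
    exact Real.rpow_le_rpow_of_nonpos hpos h1 (by linarith)
  have h3 := (summable_mul_left_iff (Real.rpow_pos_of_pos hc (-α)).ne').1 h2
  rw [Real.summable_nat_rpow] at h3
  linarith

theorem convergenceExponent_sinRatio (hν : 0 < ν) (hq : 0 < q) :
    convergenceExponent (sinRatio ν q) = 1 := by
  apply le_antisymm
  · refine ENNReal.le_of_forall_pos_le_add fun ε hε _ => ?_
    have h : Summable fun a : zeros (sinRatio ν q) =>
        (mult (sinRatio ν q) a : ℝ) * ‖(a : ℂ)‖ ^ (-((1 + ε : ℝ≥0) : ℝ)) :=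
      (summable_zeros_rpow_iff hν hq _).2 (summable_sinZero_rpow hν (by
        rw [NNReal.coe_add, NNReal.coe_one]
        exact lt_add_of_pos_right 1 hε))
    exact iInf₂_le (1 + ε) h
  · refine le_iInf₂ fun α hα => ?_
    by_contra hlt
    rw [not_le, ENNReal.coe_lt_one_iff] at hlt
    exact not_summable_sinZero_rpow hν hq α.2 (NNReal.coe_le_one.2 hlt.le)
      ((summable_zeros_rpow_iff hν hq _).1 hα)

theorem summable_zeros_blaschke (hν : 0 < ν) (hq : 0 < q) :
    Summable fun a : zeros (sinRatio ν q) => (a : ℂ).im / (1 + ‖(a : ℂ)‖ ^ 2) := by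
  rw [← (zerosEquiv hν hq).summable_iff]
  refine Summable.of_nonneg_of_le (fun n => ?_) (fun n => ?_)
    ((summable_sinZero_rpow (q := q) hν one_lt_two).mul_left (q / ν))
  · exact div_nonneg (sinZero_im_pos hν hq n).le (by positivity)
  · have hpos : 0 < ‖sinZero ν q n‖ :=
      norm_pos_iff.2 fun h => (sinZero_im_pos hν hq n).ne' (by rw [h]; rfl)
    have hqν := div_pos hq hν
    rw [Function.comp_apply, zerosEquiv_coe, sinZero_im, Real.rpow_neg hpos.le, Real.rpow_two,
      ← div_eq_mul_inv]
    gcongr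
    linarith

theorem blaschkeCondition_sinRatio (hν : 0 < ν) (hq : 0 < q) :
    BlaschkeCondition (sinRatio ν q) := by
  simpa [BlaschkeCondition, mult_sinRatio hν hq] using summable_zeros_blaschke hν hq

end zeros

/-! ### The example as a Blaschke product -/

section product

variable {ν q : ℝ}

theorem convFactor_mul_convFactor_neg_conj {a : ℂ} (ha : 0 < a.im) (hre : a.re ≠ 0) :
    convFactor a * convFactor (-conj a) = 1 := by
  have h1 : a ≠ Complex.I := fun h => hre (by simp [h])
  have h2 : -conj a ≠ Complex.I := fun h => hre (by simpa using congrArg Complex.re h)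
  have h3 := one_add_sq_ne_zero ha h1
  have h4 : 1 + (-conj a) ^ 2 = conj (1 + a ^ 2) := by simp
  have h5 : conj (1 + a ^ 2) ≠ 0 := (map_ne_zero _).2 h3
  have h6 := Complex.mul_conj' (1 + a ^ 2)
  rw [convFactor, convFactor, if_neg h1, if_neg h2, h4, Complex.norm_conj, div_mul_div_comm, h6,
    ← sq, div_self]
  rw [← h6]
  exact mul_ne_zero h3 h5

/-- This zero is purely imaginary, so `1 + a²` is real. The value `0` comes from division by zero at
`a = -i`, and is excluded once `ν, q > 0`. -/
theorem convFactor_sinZero_zero (ν q : ℝ) :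
    convFactor (sinZero ν q 0) = 1 ∨ convFactor (sinZero ν q 0) = -1 ∨
      convFactor (sinZero ν q 0) = 0 := by
  unfold convFactor
  split_ifs
  · exact Or.inl rfl
  have h : 1 + sinZero ν q 0 ^ 2 = ((1 - (q / ν) ^ 2 : ℝ) : ℂ) := by
    rw [sinZero_eq]
    push_cast
    linear_combination ((q : ℂ) / ν) ^ 2 * Complex.I_sq
  rw [h, Complex.norm_real, ← Complex.ofReal_div, Real.norm_eq_abs]
  rcases lt_trichotomy (1 - (q / ν) ^ 2) 0 with h0 | h0 | h0
  · right; left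
    rw [abs_of_neg h0, neg_div, div_self h0.ne]; simp
  · right; right
    simp [h0]
  · left
    rw [abs_of_pos h0, div_self h0.ne']; simp

theorem convFactor_sinZero_zero_eq (hν : 0 < ν) (hq : 0 < q) :
    convFactor (sinZero ν q 0) = 1 ∨ convFactor (sinZero ν q 0) = -1 := by
  rcases convFactor_sinZero_zero ν q with h | h | h
  · exact Or.inl h
  · exact Or.inr h
  · have := norm_convFactor (sinZero_im_pos hν hq 0)
    simp [h] at this

theorem prod_convFactor_sinZero (hν : 0 < ν) (hq : 0 < q) {s : Finset ℤ} (hs : ∀ n ∈ s, -n ∈ s)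
    (h0 : 0 ∈ s) : ∏ n ∈ s, convFactor (sinZero ν q n) = convFactor (sinZero ν q 0) := by
  rw [← Finset.mul_prod_erase s _ h0]
  refine (congrArg _ (Finset.prod_involution (fun n _ => -n) (fun n hn => ?_) (fun n hn _ => ?_)
    (fun n hn => ?_) fun n _ => neg_neg n)).trans (mul_one _)
  · have hn0 := (Finset.mem_erase.1 hn).1
    rw [sinZero_neg]
    refine convFactor_mul_convFactor_neg_conj (sinZero_im_pos hν hq n) ?_
    rw [sinZero_re]
    exact div_ne_zero (mul_ne_zero Real.pi_ne_zero (by exact_mod_cast hn0)) hν.ne'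
  · have hn0 := (Finset.mem_erase.1 hn).1
    omega
  · obtain ⟨hn0, hns⟩ := Finset.mem_erase.1 hn
    exact Finset.mem_erase.2 ⟨by omega, hs n hns⟩

theorem prod_Icc_neg_succ {M : Type*} [CommMonoid M] (f : ℤ → M) (N : ℕ) :
    ∏ n ∈ Finset.Icc (-((N + 1 : ℕ) : ℤ)) ((N + 1 : ℕ) : ℤ), f n =
      f (N + 1) * f (-(N + 1)) * ∏ n ∈ Finset.Icc (-(N : ℤ)) N, f n := by
  have h : Finset.Icc (-((N + 1 : ℕ) : ℤ)) ((N + 1 : ℕ) : ℤ) =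
      insert ((N : ℤ) + 1) (insert (-((N : ℤ) + 1)) (Finset.Icc (-(N : ℤ)) N)) := by
    ext n
    simp only [Finset.mem_Icc, Finset.mem_insert]
    omega
  rw [h, Finset.prod_insert (by simp only [Finset.mem_insert, Finset.mem_Icc]; omega),
    Finset.prod_insert (by simp only [Finset.mem_Icc]; omega), mul_assoc]

/-- Pairing `n` with `-n` produces the partial products of Euler's sine formula; the factors `-n²`
cancel in the quotient. -/
theorem prod_Icc_sub_div_sub (w w' : ℂ) (N : ℕ) :
    ∏ n ∈ Finset.Icc (-(N : ℤ)) N, (w - n) / (w' - n) =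
      (Real.pi * w * ∏ j ∈ Finset.range N, (1 - w ^ 2 / ((j : ℂ) + 1) ^ 2)) /
        (Real.pi * w' * ∏ j ∈ Finset.range N, (1 - w' ^ 2 / ((j : ℂ) + 1) ^ 2)) := by
  induction N with
  | zero =>
    have : (Real.pi : ℂ) ≠ 0 := by exact_mod_cast Real.pi_ne_zero
    simp [mul_div_mul_left _ _ this]
  | succ N ih =>
    have hN : ((N : ℂ) + 1) ≠ 0 := by exact_mod_cast N.succ_ne_zero
    have hN' : -((N : ℂ) + 1) ^ 2 ≠ 0 := neg_ne_zero.2 (pow_ne_zero 2 hN)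
    have e : ∀ z : ℂ, (z - ((N + 1 : ℤ) : ℂ)) * (z - ((-(N + 1) : ℤ) : ℂ)) =
        -((N : ℂ) + 1) ^ 2 * (1 - z ^ 2 / ((N : ℂ) + 1) ^ 2) := fun z => by
      push_cast
      field_simp
      ring
    rw [prod_Icc_neg_succ, ih, div_mul_div_comm, e, e, mul_div_mul_left _ _ hN', div_mul_div_comm,
      Finset.prod_range_succ, Finset.prod_range_succ]
    congr 1 <;> ring

theorem tendsto_prod_Icc_sinZero (hν : 0 < ν) (hq : 0 < q) {p : ℂ} (hp : p ∈ upperHalf) :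
    Tendsto (fun N : ℕ => ∏ n ∈ Finset.Icc (-(N : ℤ)) N,
      (p - sinZero ν q n) / (p - conj (sinZero ν q n))) atTop (𝓝 (sinRatio ν q p)) := by
  have hpi : (Real.pi : ℂ) ≠ 0 := by exact_mod_cast Real.pi_ne_zero
  have hν' : (ν : ℂ) ≠ 0 := by exact_mod_cast hν.ne'
  have hden := sinFun_neg_ne_zero hν hq (le_of_lt hp)
  set w : ℂ := (ν * p - Complex.I * q) / Real.pi with hw
  set w' : ℂ := (ν * p - Complex.I * (-q : ℝ)) / Real.pi with hw'
  have e : ∀ n : ℤ, (p - sinZero ν q n) / (p - conj (sinZero ν q n)) = (w - n) / (w' - n) := by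
    intro n
    have h1 : p - sinZero ν q n = Real.pi / ν * (w - n) := by
      rw [hw, sinZero]; field_simp; ring
    have h2 : p - conj (sinZero ν q n) = Real.pi / ν * (w' - n) := by
      rw [hw', sinZero]
      simp only [map_div₀, map_add, map_mul, Complex.conj_ofReal, Complex.conj_I, map_intCast]
      push_cast
      field_simp
      ring
    rw [h1, h2, mul_div_mul_left _ _ (div_ne_zero hpi hν')]
  have hs1 : sinFun ν q p = Complex.I * Complex.sin (Real.pi * w) := by
    rw [sinFun, hw, mul_div_cancel₀ _ hpi]
  have hs2 : sinFun ν (-q) p = Complex.I * Complex.sin (Real.pi * w') := by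
    rw [sinFun, hw', mul_div_cancel₀ _ hpi]
  simp only [e, prod_Icc_sub_div_sub]
  rw [sinRatio, hs1, hs2, mul_div_mul_left _ _ Complex.I_ne_zero]
  rw [hs2] at hden
  exact (Complex.tendsto_euler_sin_prod w).div (Complex.tendsto_euler_sin_prod w')
    (right_ne_zero_of_mul hden)

theorem hasProdLocallyUniformlyOn_sinRatio (hν : 0 < ν) (hq : 0 < q) :
    HasProdLocallyUniformlyOn (fun (a : zeros (sinRatio ν q)) (p : ℂ) => blaschkeFactor (a : ℂ) p)
      (fun p => convFactor (sinZero ν q 0) * sinRatio ν q p) upperHalf := by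
  have h := hasProdLocallyUniformlyOn_blaschkeFactor (a := fun a : zeros (sinRatio ν q) => (a : ℂ))
    (fun a => a.2.1) (summable_zeros_blaschke hν hq)
  refine h.congr_right fun p hp => ?_
  have h1 := (zerosEquiv hν hq).hasProd_iff.2 (h.hasProd hp)
  -- The unconditional limit already exists, so it may be identified along symmetric intervals,
  -- where Euler's product applies.
  have h2 := SummationFilter.hasProd_symmetricIcc_iff.1 (h1.mono_left (SummationFilter.LeAtTop.le_atTop))
  refine tendsto_nhds_unique h2 (((tendsto_prod_Icc_sinZero hν hq hp).const_mul
    (convFactor (sinZero ν q 0))).congr fun N => ?_)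
  simp only [Function.comp_apply, zerosEquiv_coe, blaschkeFactor_eq, Finset.prod_mul_distrib]
  rw [prod_convFactor_sinZero hν hq (fun n hn => ?_) (by simp)]
  rw [Finset.mem_Icc] at hn ⊢
  omega

theorem prod_convFactor_of_isSymmetricFinset (hν : 0 < ν) (hq : 0 < q)
    {s : Finset (zeros (sinRatio ν q))} (hs : IsSymmetricFinset s)
    (h0 : zerosEquiv hν hq 0 ∈ s) :
    ∏ a ∈ s, convFactor (a : ℂ) = convFactor (sinZero ν q 0) := by
  set e := zerosEquiv hν hq with he
  have h1 : ∏ a ∈ s, convFactor (a : ℂ) =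
      ∏ n ∈ s.map e.symm.toEmbedding, convFactor (sinZero ν q n) := by
    rw [Finset.prod_map]
    refine Finset.prod_congr rfl fun a _ => ?_
    rw [← zerosEquiv_coe hν hq, Equiv.coe_toEmbedding, ← he, e.apply_symm_apply]
  rw [h1]
  refine prod_convFactor_sinZero hν hq (fun n hn => ?_) ?_
  · rw [Finset.mem_map_equiv, Equiv.symm_symm] at hn ⊢
    obtain ⟨b, hb, hbn⟩ := hs _ hn
    have : e (-n) = b := Subtype.ext (by
      rw [hbn, he, zerosEquiv_coe, zerosEquiv_coe, sinZero_neg])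
    rwa [this]
  · rwa [Finset.mem_map_equiv, Equiv.symm_symm]

theorem exists_isSymmetricFinset_superset (hν : 0 < ν) (hq : 0 < q)
    (t : Finset (zeros (sinRatio ν q))) : ∃ s, IsSymmetricFinset s ∧ t ⊆ s := by
  classical
  set e := zerosEquiv hν hq with he
  have hneg : ∀ a : zeros (sinRatio ν q), (e (-e.symm a) : ℂ) = -conj (a : ℂ) := fun a => by
    conv_rhs => rw [← e.apply_symm_apply a]
    rw [he, zerosEquiv_coe, zerosEquiv_coe, sinZero_neg]
  refine ⟨t ∪ t.image fun a => e (-e.symm a), fun a ha => ?_, Finset.subset_union_left⟩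
  rcases Finset.mem_union.1 ha with h | h
  · exact ⟨_, Finset.mem_union_right _ (Finset.mem_image_of_mem _ h), hneg a⟩
  · obtain ⟨b, hb, rfl⟩ := Finset.mem_image.1 h
    refine ⟨b, Finset.mem_union_left _ hb, ?_⟩
    rw [hneg, map_neg, Complex.conj_conj, neg_neg]

theorem tendstoLocallyUniformlyOn_symmetric_sinRatio (hν : 0 < ν) (hq : 0 < q) :
    TendstoLocallyUniformlyOn
      (fun (s : {s : Finset (zeros (sinRatio ν q)) // IsSymmetricFinset s}) (p : ℂ) =>
        ∏ a ∈ s.1, ((p - (a : ℂ)) / (p - conj (a : ℂ))) ^ mult (sinRatio ν q) a)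
      (sinRatio ν q) atTop upperHalf := by
  have h := hasProdLocallyUniformlyOn_sinRatio hν hq
  rw [hasProdLocallyUniformlyOn_iff_tendstoLocallyUniformlyOn,
    Metric.tendstoLocallyUniformlyOn_iff] at h
  rw [Metric.tendstoLocallyUniformlyOn_iff]
  intro ε hε p hp
  obtain ⟨t, ht, hev⟩ := h ε hε p hp
  -- Once a symmetric set contains the zero with `n = 0`, its convergence factors multiply to
  -- exactly the sign in the limit, and the sign drops out of the distance.
  obtain ⟨s₀, hs₀⟩ := eventually_atTop.1 (hev.and (eventually_ge_atTop {zerosEquiv hν hq 0}))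
  obtain ⟨s₁, hs₁, hsub⟩ := exists_isSymmetricFinset_superset hν hq s₀
  refine ⟨t, ht, (eventually_ge_atTop ⟨s₁, hs₁⟩).mono fun s hs y hy => ?_⟩
  obtain ⟨h1, h2⟩ := hs₀ s.1 (hsub.trans hs)
  have h3 := h1 y hy
  have hσ := prod_convFactor_of_isSymmetricFinset hν hq s.2 (h2 (Finset.mem_singleton_self _))
  simp only [blaschkeFactor_eq, Finset.prod_mul_distrib, hσ] at h3
  rw [dist_eq_norm, ← mul_sub, norm_mul, norm_convFactor (sinZero_im_pos hν hq 0), one_mul,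
    ← dist_eq_norm] at h3
  simpa only [mult_sinRatio hν hq, pow_one] using h3

theorem sinRatio_ofReal (ν q p : ℝ) : sinRatio ν q p =
    -(Complex.exp (2 * Complex.I * ν * p) * conj (outerPart ν q p)) / outerPart ν q p := by
  rw [sinRatio_eq, outerPart_neg_ofReal]

theorem isSymmetricInner_sinRatio (hν : 0 < ν) (hq : 0 < q) :
    IsSymmetricInner (sinRatio ν q) := by
  refine ⟨fun p hp => (differentiableAt_sinRatio hν hq (le_of_lt hp)).differentiableWithinAt,
    ⟨Real.cosh q / Real.sinh q, fun p hp => ?_⟩, ae_of_all _ fun p _ => ?_⟩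
  · have hp' : 0 ≤ p.im := le_of_lt hp
    rw [sinRatio_eq, norm_div, norm_neg]
    refine div_le_div₀ (Real.cosh_pos q).le ?_ (Real.sinh_pos_iff.2 hq)
      (sinh_le_norm_outerPart hν hp')
    -- `A(-p)` alone is unbounded on the upper half plane; the factor `e^{2iνp}` compensates its
    -- growth.
    have e : Complex.exp (2 * Complex.I * ν * p) * outerPart ν q (-p) =
        (Complex.exp (-q : ℝ) - Complex.exp q * Complex.exp (Complex.I * (2 * ν : ℝ) * p)) / 2 := by
      rw [outerPart, mul_div_assoc', mul_sub, ← Complex.exp_add, mul_comm (Complex.exp (q : ℂ))]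
      congr 3
      · push_cast; ring
      · push_cast; ring_nf
    have h1 := norm_sub_le (Complex.exp (-q : ℝ))
      (Complex.exp q * Complex.exp (Complex.I * (2 * ν : ℝ) * p))
    rw [norm_mul, Complex.norm_exp_ofReal, Complex.norm_exp_ofReal] at h1
    have h2 := mul_le_mul_of_nonneg_left
      (norm_exp_I_mul_le_one (c := 2 * ν) (by positivity) hp') (Real.exp_pos q).le
    rw [e, norm_div, Complex.norm_ofNat, Real.cosh_eq]
    linarith
  · have hA : outerPart ν q p ≠ 0 := outerPart_ne_zero hν hq (by simp)
    have hA' : conj (outerPart ν q p) ≠ 0 := (map_ne_zero _).2 hA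
    have hE : conj (Complex.exp (2 * Complex.I * ν * p)) =
        (Complex.exp (2 * Complex.I * ν * p))⁻¹ := by
      rw [← Complex.exp_conj, ← Complex.exp_neg]
      simp only [map_mul, Complex.conj_ofReal, Complex.conj_I, map_ofNat]
      ring_nf
    have hE0 := Complex.exp_ne_zero (2 * Complex.I * ν * p)
    have hφ := sinRatio_ofReal ν q p
    have hsymm : sinRatio ν q (-p : ℝ) = conj (sinRatio ν q p) := by
      have hm : Complex.exp (2 * Complex.I * ν * (-p : ℝ)) =
          (Complex.exp (2 * Complex.I * ν * p))⁻¹ := by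
        rw [← Complex.exp_neg]; push_cast; ring_nf
      rw [sinRatio_ofReal, sinRatio_ofReal, hm, Complex.ofReal_neg, outerPart_neg_ofReal, map_div₀,
        map_neg, map_mul, hE]
    refine ⟨sinRatio ν q p, tendsto_add_mul_I
      (differentiableAt_sinRatio hν hq (by simp)).continuousAt, ?_, ?_, ?_⟩
    · rw [← hsymm, ← Complex.ofReal_neg]
      exact tendsto_add_mul_I (differentiableAt_sinRatio hν hq (Complex.ofReal_im _).ge).continuousAt
    · rw [hφ]
      exact div_ne_zero (neg_ne_zero.2 (mul_ne_zero hE0 hA')) hA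
    · rw [hφ, map_div₀, map_neg, map_mul, hE, Complex.conj_conj]
      field_simp

theorem isSymmetricBlaschkeProduct_sinRatio (hν : 0 < ν) (hq : 0 < q) :
    IsSymmetricBlaschkeProduct (sinRatio ν q) :=
  ⟨isSymmetricInner_sinRatio hν hq, blaschkeCondition_sinRatio hν hq,
    tendstoLocallyUniformlyOn_symmetric_sinRatio hν hq⟩

/-! ### The canonical factorization -/

theorem im_singular_integrand {y : ℝ} (hy : 0 < y) (t : ℝ) :
    ((1 + (y * Complex.I) * t) / (y * Complex.I - t)).im =
      -(y * (1 + t ^ 2) / (y ^ 2 + t ^ 2)) := by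
  have h : (0 : ℝ) < y ^ 2 + t ^ 2 := by positivity
  rw [Complex.div_im, Complex.normSq_apply]
  simp
  have h' : t * t + y * y ≠ 0 := by nlinarith
  field_simp
  ring

theorem norm_singular_integrand_le {y : ℝ} (hy : 1 ≤ y) (t : ℝ) :
    ‖(1 + (y * Complex.I) * t) / (y * Complex.I - t)‖ ≤ y := by
  have hne : y * Complex.I - t ≠ 0 := fun h => by
    have := congrArg Complex.im h
    simp at this
    linarith
  rw [norm_div, div_le_iff₀ (norm_pos_iff.2 hne)]
  refine le_of_sq_le_sq ?_ (by positivity)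
  rw [mul_pow, Complex.sq_norm, Complex.sq_norm, Complex.normSq_apply, Complex.normSq_apply]
  simp
  nlinarith [mul_self_nonneg t, mul_self_nonneg (y * y - 1), one_le_mul_of_one_le_of_one_le hy hy]

/-- If the exponential and the singular factor of a canonical factorization have product of modulus
one at some point of the imaginary axis, they are trivial. -/
theorem eq_zero_of_norm_exp_mul_singularFactor {x y : ℝ} {μ : Measure ℝ} [IsFiniteMeasure μ]
    (hx : 0 ≤ x) (hy : 1 ≤ y)
    (h : ‖Complex.exp (Complex.I * (y * Complex.I) * x) * singularFactor μ (y * Complex.I)‖ = 1) :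
    x = 0 ∧ μ = 0 := by
  have hy0 : 0 < y := by linarith
  have hne : ∀ t : ℝ, y * Complex.I - t ≠ 0 := fun t h => by
    have := congrArg Complex.im h
    simp at this
    linarith
  have hint : Integrable (fun t : ℝ => (1 + (y * Complex.I) * t) / (y * Complex.I - t)) μ :=
    Integrable.of_bound (Continuous.aestronglyMeasurable
      (Continuous.div (by fun_prop) (by fun_prop) hne)) y
      (ae_of_all _ (norm_singular_integrand_le hy))
  have him : (∫ t : ℝ, (1 + (y * Complex.I) * t) / (y * Complex.I - t) ∂μ).im =
      -∫ t : ℝ, y * (1 + t ^ 2) / (y ^ 2 + t ^ 2) ∂μ := by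
    rw [← integral_neg]
    simp only [← im_singular_integrand hy0]
    exact (integral_im hint).symm
  -- The integrand is at least `1/y` because `y ≥ 1`. A vanishing exponent therefore leaves no mass
  -- for `μ`, and since `yx ≥ 0` it also forces `x = 0`.
  have hle : ∫ _ : ℝ, y⁻¹ ∂μ ≤ ∫ t : ℝ, y * (1 + t ^ 2) / (y ^ 2 + t ^ 2) ∂μ := by
    refine integral_mono (integrable_const _) ?_ fun t => ?_
    · refine (hint.im.neg).congr (ae_of_all _ fun t => ?_)
      have := im_singular_integrand hy0 t
      simp only [Pi.neg_apply, RCLike.im_eq_complex_im, this, neg_neg]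
    · have : (0 : ℝ) < y ^ 2 + t ^ 2 := by positivity
      change y⁻¹ ≤ y * (1 + t ^ 2) / (y ^ 2 + t ^ 2)
      rw [inv_eq_one_div, div_le_div_iff₀ hy0 this]
      nlinarith [sq_nonneg t, one_le_mul_of_one_le_of_one_le hy hy,
        mul_nonneg (sub_nonneg.2 (one_le_mul_of_one_le_of_one_le hy hy)) (sq_nonneg t)]
  rw [norm_mul, singularFactor, Complex.norm_exp, Complex.norm_exp, ← Real.exp_add,
    Real.exp_eq_one_iff] at h
  have e1 : (Complex.I * (y * Complex.I) * x).re = -(y * x) := by simp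
  have e2 : ∀ z : ℂ, (-Complex.I * z).re = z.im := fun z => by simp
  rw [e1, e2, him] at h
  rw [integral_const, smul_eq_mul] at hle
  have h1 : 0 ≤ y * x := mul_nonneg hy0.le hx
  have h2 : 0 ≤ μ.real univ * y⁻¹ := by positivity
  constructor
  · have : y * x = 0 := by linarith
    exact (mul_eq_zero.1 this).resolve_left hy0.ne'
  · have h3 : μ.real univ * y⁻¹ = 0 := by linarith
    have h4 := (mul_eq_zero.1 h3).resolve_right (inv_ne_zero hy0.ne')
    rwa [measureReal_eq_zero_iff, Measure.measure_univ_eq_zero] at h4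

theorem isCanonicalFactorization_sinRatio_iff (hν : 0 < ν) (hq : 0 < q) (x : ℝ) (μ : Measure ℝ) :
    IsCanonicalFactorization (sinRatio ν q) x μ ↔ x = 0 ∧ μ = 0 := by
  have hprod := hasProdLocallyUniformlyOn_sinRatio hν hq
  have hσ := convFactor_sinZero_zero_eq hν hq
  constructor
  · intro h
    obtain ⟨τ, B, hτ, hB, hfac⟩ := h.factorization
    simp only [mult_sinRatio hν hq, pow_one] at hB
    -- All zeros have imaginary part `q/ν`, so the point `i(q/ν + 1)` avoids them and `|φ|` can be
    -- cancelled against `|B|`.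
    have hy : 1 ≤ q / ν + 1 := by linarith [div_pos hq hν]
    have hp : ((q / ν + 1 : ℝ) : ℂ) * Complex.I ∈ upperHalf := by
      change 0 < (((q / ν + 1 : ℝ) : ℂ) * Complex.I).im
      rw [Complex.im_ofReal_mul, Complex.I_im]
      linarith
    have h0 : sinRatio ν q (((q / ν + 1 : ℝ) : ℂ) * Complex.I) ≠ 0 := fun h0 => by
      obtain ⟨n, hn⟩ := (sinRatio_eq_zero_iff hν hq (le_of_lt hp)).1 h0
      have := congrArg Complex.im hn
      rw [sinZero_im, Complex.im_ofReal_mul, Complex.I_im] at this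
      linarith
    have hfp := congrArg norm (hfac _ hp)
    have hBp := (hB.hasProd hp).unique (hprod.hasProd hp)
    have hτ1 : ‖τ‖ = 1 := by rcases hτ with rfl | rfl <;> simp
    rw [hBp, norm_mul, norm_mul, norm_mul, norm_mul, norm_convFactor (sinZero_im_pos hν hq 0), hτ1,
      one_mul, one_mul] at hfp
    have := h.finite
    refine eq_zero_of_norm_exp_mul_singularFactor h.shift_nonneg hy ?_
    rw [norm_mul]
    refine mul_left_cancel₀ (norm_ne_zero_iff.2 h0) ?_
    rw [mul_one]
    linarith
  · rintro ⟨rfl, rfl⟩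
    refine ⟨le_rfl, inferInstance, Measure.MutuallySingular.zero_left, Measure.map_zero _,
      blaschkeCondition_sinRatio hν hq, convFactor (sinZero ν q 0),
      fun p => convFactor (sinZero ν q 0) * sinRatio ν q p, hσ, ?_, fun p _ => ?_⟩
    · simpa only [mult_sinRatio hν hq, pow_one] using hprod
    · have : convFactor (sinZero ν q 0) * convFactor (sinZero ν q 0) = 1 := by
        rcases hσ with h | h <;> simp [h]
      simp [singularFactor, ← mul_assoc, this]

end product

end LocalizationRadius

end

theorem mainTheorem5 :
    (∀ ν q : ℝ, 0 < ν → 0 < q →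
      LocalizationRadius.IsSymmetricBlaschkeProduct (LocalizationRadius.sinRatio ν q) ∧
      (∀ (x : ℝ) (μ : MeasureTheory.Measure ℝ),
        LocalizationRadius.IsCanonicalFactorization (LocalizationRadius.sinRatio ν q) x μ ↔
          x = 0 ∧ μ = 0) ∧
      LocalizationRadius.convergenceExponent (LocalizationRadius.sinRatio ν q) = 1 ∧
      LocalizationRadius.localizationRadius (LocalizationRadius.sinRatio ν q) =
        ENNReal.ofReal ν) ∧
    (∀ r : ℝ, 0 < r → ∃ φ : ℂ → ℂ,
      LocalizationRadius.IsSymmetricBlaschkeProduct φ ∧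
      (∀ (x : ℝ) (μ : MeasureTheory.Measure ℝ),
        LocalizationRadius.IsCanonicalFactorization φ x μ ↔ x = 0 ∧ μ = 0) ∧
      LocalizationRadius.convergenceExponent φ = 1 ∧
      LocalizationRadius.localizationRadius φ = ENNReal.ofReal r) := by
  have main : ∀ ν q : ℝ, 0 < ν → 0 < q →
      LocalizationRadius.IsSymmetricBlaschkeProduct (LocalizationRadius.sinRatio ν q) ∧
      (∀ (x : ℝ) (μ : MeasureTheory.Measure ℝ),
        LocalizationRadius.IsCanonicalFactorization (LocalizationRadius.sinRatio ν q) x μ ↔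
          x = 0 ∧ μ = 0) ∧
      LocalizationRadius.convergenceExponent (LocalizationRadius.sinRatio ν q) = 1 ∧
      LocalizationRadius.localizationRadius (LocalizationRadius.sinRatio ν q) =
        ENNReal.ofReal ν := fun ν q hν hq =>
    ⟨LocalizationRadius.isSymmetricBlaschkeProduct_sinRatio hν hq,
      LocalizationRadius.isCanonicalFactorization_sinRatio_iff hν hq,
      LocalizationRadius.convergenceExponent_sinRatio hν hq,
      LocalizationRadius.localizationRadius_sinRatio hν hq⟩
  -- The radius depends on `ν` only; any positive `q` would do.
  exact ⟨main, fun r hr => ⟨LocalizationRadius.sinRatio r 1, main r 1 hr one_pos⟩⟩
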